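/- **Setting.** Let $d\in\{2,3\}$ and let $\Omega\subset\mathbb R^d$ be a bounded Lipschitz domain that carries a conforming simplicial mesh $\mathcal T_H$ (a finite set of closed nondegenerate $d$-simplices covering $\overline\Omega$, any two of which are disjoint or meet in a common subsimplex) of mesh size $H=\max_{T\in\mathcal T_H}\operatorname{diam}T$. Let $\mathbf A\in L^\infty(\Omega,\mathbb R^{d\times d})$ be a.e. symmetric positive definite, with real numbers $0<\alpha\le\beta$ such that for a.e. $x\in\Omega$ $$\alpha\,|\boldsymbol\xi|^2\le(\mathbf A(x)^{-1}\boldsymbol\xi)\cdot\boldsymbol\xi\le\beta\,|\boldsymbol\xi|^2\qquad\text{for all }\boldsymbol\xi\in\mathbb R^d.$$ Let $\mathbf H_0(\operatorname{div},\Omega)$ be the space of fields in $L^2(\Omega,\mathbb R^d)$ with weak divergence in $L^2(\Omega)$ and vanishing normal trace on $\partial\Omega$, and set $\|\mathbf v\|_{\mathbf H(\operatorname{div},\Omega)}^2=\|\mathbf v\|_{L^2(\Omega)}^2+\|\operatorname{div}\mathbf v\|_{L^2(\Omega)}^2$. Let $L^2_0(\Omega)$ be the space of zero-mean functions in $L^2(\Omega)$,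 and put $$a(\mathbf u,\mathbf v)=(\mathbf A^{-1}\mathbf u,\mathbf v)_{L^2(\Omega)},\qquad b(\mathbf v,q)=(\operatorname{div}\mathbf v,q)_{L^2(\Omega)}.$$ For $k\in\mathbb N_0$ let $Q_H^k$ be the space of $\mathcal T_H$-piecewise polynomials of degree at most $k$, $\mathrm P_H:L^2(\Omega)\to Q_H^k$ the $L^2$-orthogonal projection, and let $V_H^k$ be the space of all $\mathbf v\in\mathbf H_0(\operatorname{div},\Omega)$ with $\mathbf v|_T\in[\mathbb P_k(T)]^d+\boldsymbol x\,\mathbb P_k(T)$ for every $T\in\mathcal T_H$. Let $\pi_H:\mathbf H_0(\operatorname{div},\Omega)\to V_H^k$ be a linear map that is surjective with $\pi_H\circ\pi_H=\pi_H$, satisfies $\operatorname{div}(\pi_H\mathbf v)=\mathrm P_H(\operatorname{div}\mathbf v)$ for all $\mathbf v$, and is locally stable: for some $C>0$ and all $\mathbf v\in\mathbf H_0(\operatorname{div},\Omega)$, $T\in\mathcal T_H$, $$\|\pi_H\mathbf v\|_{L^2(T)}^2+H^2\|\operatorname{div}\pi_H\mathbf v\|_{L^2(T)}^2\le C\left(\|\mathbf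 v\|_{L^2(N^1(T))}^2+H^2\|\operatorname{div}\mathbf v\|_{L^2(N^1(T))}^2\right),$$ where $N^1(T)$ is the union of all $K\in\mathcal T_H$ with $K\cap T\ne\emptyset$. Let $W_{\operatorname{div}0}=\{\mathbf w\in\mathbf H_0(\operatorname{div},\Omega):\operatorname{div}\mathbf w=0,\ \pi_H\mathbf w=\mathbf 0\}$. For $T\in\mathcal T_H$ let $\mathcal C_T\mathbf v\in W_{\operatorname{div}0}$ be given by $$a(\mathcal C_T\mathbf v,\mathbf w)=(\mathbf A^{-1}\mathbf v,\mathbf w)_{L^2(T)}\qquad\text{for all }\mathbf w\in W_{\operatorname{div}0},$$ and put $\mathcal C=\sum_{T\in\mathcal T_H}\mathcal C_T$ and $V_H^{k,\mathrm{ms}}=(\operatorname{id}-\mathcal C)V_H^k$. **Lemma (Well-posedness of the ideal multiscale problem).** There is a constant $\rho>0$ with $$\inf_{q_H\in Q_H^k\cap L^2_0(\Omega)\setminus\{0\}}\ \sup_{\mathbf v_H\in V_H^k\setminus\{\mathbf 0\}}\frac{b(\mathbf v_H,q_H)}{\|q_H\|_{L^2(\Omega)}\|\mathbf v_H\|_{\mathbf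 H(\operatorname{div},\Omega)}}\ge\rho,$$ and for every $\rho>0$ with this property, $$\sup_{\mathbf v\in V_H^{k,\mathrm{ms}}\setminus\{\mathbf 0\}}\frac{b(\mathbf v,q_H)}{\|q_H\|_{L^2(\Omega)}\|\mathbf v\|_{\mathbf H(\operatorname{div},\Omega)}}\ge\rho\,(1+\alpha^{-1}\beta)^{-1}\qquad\text{for all }q_H\in Q_H^k\cap L^2_0(\Omega)\setminus\{0\}.$$ Moreover, for every $f\in L^2_0(\Omega)$ there is a unique pair $(\mathbf u_H^{\mathrm{ms}},p_H)\in V_H^{k,\mathrm{ms}}\times(Q_H^k\cap L^2_0(\Omega))$ such that $$a(\mathbf u_H^{\mathrm{ms}},\mathbf v)+b(\mathbf v,p_H)=0\quad\text{for all }\mathbf v\in V_H^{k,\mathrm{ms}},\qquad b(\mathbf u_H^{\mathrm{ms}},q_H)=-(f,q_H)_{L^2(\Omega)}\quad\text{for all }q_H\in Q_H^k.$$ -/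

import Mathlib

open MeasureTheory
open scoped ContDiff NNReal

namespace MixedLOD

noncomputable section

/-- The Euclidean space `ℝ^d`. -/
abbrev Pt (d : ℕ) : Type := EuclideanSpace ℝ (Fin d)

/-- The scalar Lebesgue space `L²(Ω)`. -/
abbrev L2 {d : ℕ} (Ω : Set (Pt d)) : Type := Lp ℝ 2 (volume.restrict Ω)

/-- The vector-valued Lebesgue space `L²(Ω, ℝ^d)`. -/
abbrev L2v {d : ℕ} (Ω : Set (Pt d)) : Type := Lp (Pt d) 2 (volume.restrict Ω)

/-- Bounded Lipschitz domain: nonempty, open, connected, bounded, and near each boundary point,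
after a choice of a unit direction `ν`, the set lies strictly above the graph of a Lipschitz
function `γ` over the hyperplane orthogonal to `ν` (the point `y - ⟪ν, y⟫ ν` is the orthogonal
projection of `y` onto that hyperplane). -/
structure IsBoundedLipschitzDomain {d : ℕ} (Ω : Set (Pt d)) : Prop where
  isOpen : IsOpen Ω
  isConnected : IsConnected Ω
  isBounded : Bornology.IsBounded Ω
  lipschitz_boundary : ∀ x ∈ frontier Ω, ∃ (ν : Pt d) (r : ℝ) (L : ℝ≥0) (γ : Pt d → ℝ),
    ‖ν‖ = 1 ∧ 0 < r ∧ LipschitzWith L γ ∧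
      ∀ y ∈ Metric.ball x r, (y ∈ Ω ↔ γ (y - inner ℝ ν y • ν) < inner ℝ ν y)

/-! ### The spaces `H(div, Ω)`, `H₀(div, Ω)` and `L²₀(Ω)` -/

/-- Smooth compactly supported real functions on `ℝ^d`. -/
def IsTest {d : ℕ} (φ : Pt d → ℝ) : Prop := ContDiff ℝ ∞ φ ∧ HasCompactSupport φ

/-- `g ∈ L²(Ω)` is the weak divergence of `u ∈ L²(Ω, ℝ^d)`:
`∫_Ω u · ∇φ = - ∫_Ω g φ` for all `φ ∈ C_c^∞(Ω)`. Here `fderiv ℝ φ x (u x)` is `u(x) · ∇φ(x)`. -/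
def HasWeakDiv {d : ℕ} (Ω : Set (Pt d)) (u : L2v Ω) (g : L2 Ω) : Prop :=
  ∀ φ : Pt d → ℝ, IsTest φ → tsupport φ ⊆ Ω →
    ∫ x in Ω, fderiv ℝ φ x (u x) = - ∫ x in Ω, g x * φ x

open Classical in
/-- The weak divergence of `u` (meaningful for `u ∈ H(div, Ω)`, and then unique for open `Ω`). -/
def weakDiv {d : ℕ} (Ω : Set (Pt d)) (u : L2v Ω) : L2 Ω :=
  if h : ∃ g : L2 Ω, HasWeakDiv Ω u g then h.choose else 0

/-- The norm of `H(div, Ω)`. -/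
def hdivNorm {d : ℕ} (Ω : Set (Pt d)) (u : L2v Ω) : ℝ :=
  Real.sqrt (‖u‖ ^ 2 + ‖weakDiv Ω u‖ ^ 2)

/-- The normal trace of `u`, with weak divergence `g`, vanishes on `∂Ω`. The normal trace is the
functional `φ ↦ ∫_Ω u · ∇φ + ∫_Ω g φ` given by Green's formula, tested with the restrictions to
`Ω` of functions in `C_c^∞(ℝ^d)`, which are dense in `H¹(Ω)` for a bounded Lipschitz domain. -/
def NormalTraceZero {d : ℕ} (Ω : Set (Pt d)) (u : L2v Ω) (g : L2 Ω) : Prop :=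
  ∀ φ : Pt d → ℝ, IsTest φ →
    (∫ x in Ω, fderiv ℝ φ x (u x)) + ∫ x in Ω, g x * φ x = 0

theorem integrable_fderiv_apply {d : ℕ} {Ω : Set (Pt d)} (u : L2v Ω) {φ : Pt d → ℝ}
    (hφ : IsTest φ) : Integrable (fun x => fderiv ℝ φ x (u x)) (volume.restrict Ω) := by
  have hc : Continuous (fderiv ℝ φ) := hφ.1.continuous_fderiv (by simp)
  have h1 : MemLp (fderiv ℝ φ) 2 (volume.restrict Ω) :=
    (hc.memLp_of_hasCompactSupport (hφ.2.fderiv (𝕜 := ℝ))).restrict Ω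
  have h2 := h1.norm.integrable_mul (Lp.memLp u).norm
  refine h2.mono' ?_ (Filter.Eventually.of_forall fun x => (fderiv ℝ φ x).le_opNorm _)
  exact (ContinuousLinearMap.apply ℝ ℝ : Pt d →L[ℝ] (Pt d →L[ℝ] ℝ) →L[ℝ] ℝ)
    |>.aestronglyMeasurable_comp₂ (Lp.aestronglyMeasurable u) h1.aestronglyMeasurable

theorem integrable_mul_test {d : ℕ} {Ω : Set (Pt d)} (g : L2 Ω) {φ : Pt d → ℝ}
    (hφ : IsTest φ) : Integrable (fun x => g x * φ x) (volume.restrict Ω) :=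
  (Lp.memLp g).integrable_mul
    ((hφ.1.continuous.memLp_of_hasCompactSupport (p := 2) hφ.2).restrict Ω)

/-- The weak divergence on an open set is unique. -/
theorem HasWeakDiv.unique {d : ℕ} {Ω : Set (Pt d)} (hΩ : IsOpen Ω) {u : L2v Ω} {g h : L2 Ω}
    (hg : HasWeakDiv Ω u g) (hh : HasWeakDiv Ω u h) : g = h := by
  have key : ∀ᵐ x ∂(volume : Measure (Pt d)), x ∈ Ω → g x - h x = 0 := by
    refine hΩ.ae_eq_zero_of_integral_contDiff_smul_eq_zero ?_ ?_
    · refine LocallyIntegrableOn.mono_set (t := Ω) ?_ subset_rfl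
      rw [locallyIntegrableOn_iff hΩ.isLocallyClosed]
      intro K hK hKc
      have h1 : MemLp (fun x => g x - h x) 2 ((volume.restrict Ω).restrict K) :=
        ((Lp.memLp g).sub (Lp.memLp h)).restrict K
      rw [Measure.restrict_restrict hKc.measurableSet, Set.inter_eq_left.2 hK] at h1
      have : IsFiniteMeasure ((volume : Measure (Pt d)).restrict K) :=
        ⟨by simpa using hKc.measure_lt_top⟩
      exact h1.integrable (by norm_num)
    · intro φ hφ hc hs
      have e1 := hg φ ⟨hφ, hc⟩ hs
      have e2 := hh φ ⟨hφ, hc⟩ hs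
      have e3 : ∫ x in Ω, φ x • (g x - h x) = ∫ x, φ x • (g x - h x) := by
        refine setIntegral_eq_integral_of_forall_compl_eq_zero fun x hx => ?_
        rw [image_eq_zero_of_notMem_tsupport fun hx' => hx (hs hx'), zero_smul]
      rw [← e3]
      have e4 : ∫ x in Ω, φ x • (g x - h x) = (∫ x in Ω, g x * φ x) - ∫ x in Ω, h x * φ x := by
        rw [← integral_sub (integrable_mul_test g ⟨hφ, hc⟩) (integrable_mul_test h ⟨hφ, hc⟩)]
        refine integral_congr_ae (Filter.Eventually.of_forall fun x => ?_)
        simp only [smul_eq_mul]; ring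
      rw [e4]; linarith
  refine Lp.ext ?_
  filter_upwards [(ae_restrict_iff' hΩ.measurableSet).2 key] with x hx
  linarith

theorem HasWeakDiv.weakDiv_eq {d : ℕ} {Ω : Set (Pt d)} (hΩ : IsOpen Ω) {u : L2v Ω} {g : L2 Ω}
    (hg : HasWeakDiv Ω u g) : weakDiv Ω u = g := by
  have h : ∃ g : L2 Ω, HasWeakDiv Ω u g := ⟨g, hg⟩
  rw [weakDiv, dif_pos h]
  exact h.choose_spec.unique hΩ hg

theorem integral_fderiv_add {d : ℕ} {Ω : Set (Pt d)} (u v : L2v Ω) {φ : Pt d → ℝ}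
    (hφ : IsTest φ) : ∫ x in Ω, fderiv ℝ φ x ((u + v) x) =
      (∫ x in Ω, fderiv ℝ φ x (u x)) + ∫ x in Ω, fderiv ℝ φ x (v x) := by
  rw [← integral_add (integrable_fderiv_apply u hφ) (integrable_fderiv_apply v hφ)]
  refine integral_congr_ae ?_
  filter_upwards [Lp.coeFn_add u v] with x hx
  rw [hx, Pi.add_apply, map_add]

theorem integral_fderiv_smul {d : ℕ} {Ω : Set (Pt d)} (c : ℝ) (u : L2v Ω) (φ : Pt d → ℝ) :
    ∫ x in Ω, fderiv ℝ φ x ((c • u) x) = c * ∫ x in Ω, fderiv ℝ φ x (u x) := by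
  rw [← integral_const_mul]
  refine integral_congr_ae ?_
  filter_upwards [Lp.coeFn_smul c u] with x hx
  simp [hx]

theorem integral_mul_test_add {d : ℕ} {Ω : Set (Pt d)} (g h : L2 Ω) {φ : Pt d → ℝ}
    (hφ : IsTest φ) : ∫ x in Ω, (g + h) x * φ x =
      (∫ x in Ω, g x * φ x) + ∫ x in Ω, h x * φ x := by
  rw [← integral_add (integrable_mul_test g hφ) (integrable_mul_test h hφ)]
  refine integral_congr_ae ?_
  filter_upwards [Lp.coeFn_add g h] with x hx
  rw [hx, Pi.add_apply, add_mul]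

theorem integral_mul_test_smul {d : ℕ} {Ω : Set (Pt d)} (c : ℝ) (g : L2 Ω) (φ : Pt d → ℝ) :
    ∫ x in Ω, (c • g) x * φ x = c * ∫ x in Ω, g x * φ x := by
  rw [← integral_const_mul]
  refine integral_congr_ae ?_
  filter_upwards [Lp.coeFn_smul c g] with x hx
  simp [hx, mul_assoc]

/-- The space `H₀(div, Ω)` of fields in `L²(Ω, ℝ^d)` with a weak divergence in `L²(Ω)` and
vanishing normal trace. -/
def H0div {d : ℕ} (Ω : Set (Pt d)) : Submodule ℝ (L2v Ω) where
  carrier := {u | ∃ g : L2 Ω, HasWeakDiv Ω u g ∧ NormalTraceZero Ω u g}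
  zero_mem' := by
    have h0 : ∀ φ : Pt d → ℝ, ∫ x in Ω, fderiv ℝ φ x ((0 : L2v Ω) x) = 0 := fun φ => by
      have := integral_fderiv_smul (0 : ℝ) (0 : L2v Ω) φ
      simpa using this
    have h1 : ∀ φ : Pt d → ℝ, ∫ x in Ω, (0 : L2 Ω) x * φ x = 0 := fun φ => by
      have := integral_mul_test_smul (0 : ℝ) (0 : L2 Ω) φ
      simpa using this
    exact ⟨0, fun φ _ _ => by rw [h0, h1, neg_zero], fun φ _ => by rw [h0, h1, add_zero]⟩
  add_mem' := by
    rintro u v ⟨g, hg, hg'⟩ ⟨h, hh, hh'⟩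
    refine ⟨g + h, fun φ hφ hs => ?_, fun φ hφ => ?_⟩
    · rw [integral_fderiv_add u v hφ, integral_mul_test_add g h hφ, hg φ hφ hs, hh φ hφ hs]
      ring
    · rw [integral_fderiv_add u v hφ, integral_mul_test_add g h hφ]
      linarith [hg' φ hφ, hh' φ hφ]
  smul_mem' := by
    rintro c u ⟨g, hg, hg'⟩
    refine ⟨c • g, fun φ hφ hs => ?_, fun φ hφ => ?_⟩
    · rw [integral_fderiv_smul, integral_mul_test_smul, hg φ hφ hs]
      ring
    · rw [integral_fderiv_smul, integral_mul_test_smul, ← mul_add, hg' φ hφ, mul_zero]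

/-- `q` has zero mean, i.e. `q ∈ L²₀(Ω)`. -/
def ZeroMean {d : ℕ} (Ω : Set (Pt d)) (q : L2 Ω) : Prop := ∫ x in Ω, q x = 0

/-! ### Coefficient and bilinear forms -/

/-- `A ∈ L^∞(Ω, ℝ^{d×d})` is almost everywhere symmetric positive definite, and `α`, `β` are
spectral bounds of `A⁻¹`. -/
structure IsCoefficient {d : ℕ} (Ω : Set (Pt d)) (A : Pt d → Matrix (Fin d) (Fin d) ℝ)
    (α β : ℝ) : Prop where
  memLp_top : ∀ i j, MemLp (fun x => A x i j) ⊤ (volume.restrict Ω)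
  posDef : ∀ᵐ x ∂(volume.restrict Ω), (A x).PosDef
  alpha_pos : 0 < α
  bounds : ∀ᵐ x ∂(volume.restrict Ω), ∀ ξ : Fin d → ℝ, ξ ≠ 0 →
    α ≤ (((A x)⁻¹).mulVec ξ ⬝ᵥ ξ) / (ξ ⬝ᵥ ξ) ∧ (((A x)⁻¹).mulVec ξ ⬝ᵥ ξ) / (ξ ⬝ᵥ ξ) ≤ β

/-- `(A⁻¹ u, v)_{L²(S ∩ Ω)}`. -/
def formAOn {d : ℕ} {Ω : Set (Pt d)} (A : Pt d → Matrix (Fin d) (Fin d) ℝ) (S : Set (Pt d))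
    (u v : L2v Ω) : ℝ :=
  ∫ x in S, (((A x)⁻¹).mulVec (u x).ofLp ⬝ᵥ (v x).ofLp) ∂(volume.restrict Ω)

/-- The bilinear form `a(u, v) = (A⁻¹ u, v)_{L²(Ω)}`. -/
def formA {d : ℕ} {Ω : Set (Pt d)} (A : Pt d → Matrix (Fin d) (Fin d) ℝ) (u v : L2v Ω) : ℝ :=
  ∫ x in Ω, (((A x)⁻¹).mulVec (u x).ofLp ⬝ᵥ (v x).ofLp)

/-- The bilinear form `b(v, q) = (div v, q)_{L²(Ω)}`. -/
def formB {d : ℕ} {Ω : Set (Pt d)} (v : L2v Ω) (q : L2 Ω) : ℝ := inner ℝ (weakDiv Ω v) q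

/-- `sup_{v ∈ V \ {0}} b(v, q) / (‖q‖_{L²} ‖v‖_{H(div)})`, in the extended reals (so `-∞` if
`V \ {0}` is empty). -/
def supQuot {d : ℕ} {Ω : Set (Pt d)} (V : Set (L2v Ω)) (q : L2 Ω) : EReal :=
  ⨆ v ∈ V \ {0}, ((formB v q / (‖q‖ * hdivNorm Ω v) : ℝ) : EReal)

/-- `inf_{q ∈ Q \ {0}} sup_{v ∈ V \ {0}} b(v, q) / (‖q‖_{L²} ‖v‖_{H(div)})`. -/
def infSup {d : ℕ} {Ω : Set (Pt d)} (V : Set (L2v Ω)) (Q : Set (L2 Ω)) : EReal :=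
  ⨅ q ∈ Q \ {0}, supQuot V q

/-! ### Mesh and finite element spaces -/

/-- A conforming simplicial mesh over `Ω`: a finite family of nondegenerate `d`-simplices, each
given by its `d + 1` vertices, which cover the closure of `Ω`, such that the intersection of any
two of them is the subsimplex spanned by their common vertices (or empty). A single finite mesh is
always shape-regular and quasi-uniform for some constants. -/
structure Mesh {d : ℕ} (Ω : Set (Pt d)) where
  elements : Finset (Finset (Pt d))
  card_eq : ∀ T ∈ elements, T.card = d + 1
  affineIndependent : ∀ T ∈ elements, AffineIndependent ℝ ((↑) : T → Pt d)
  conforming : ∀ T ∈ elements, ∀ T' ∈ elements,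
    convexHull ℝ (T : Set (Pt d)) ∩ convexHull ℝ (T' : Set (Pt d)) =
      convexHull ℝ ((T : Set (Pt d)) ∩ (T' : Set (Pt d)))
  covers : ⋃ T ∈ elements, convexHull ℝ (T : Set (Pt d)) = closure Ω

/-- The closed simplex with the given vertices. -/
def cell {d : ℕ} (T : Finset (Pt d)) : Set (Pt d) := convexHull ℝ (T : Set (Pt d))

/-- The mesh size `H`, the maximal element diameter. -/
def Mesh.size {d : ℕ} {Ω : Set (Pt d)} (M : Mesh Ω) : ℝ :=
  ⨆ T : M.elements, Metric.diam (cell T.1)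

/-- The element patch `N¹(T)`. -/
def Mesh.patch {d : ℕ} {Ω : Set (Pt d)} (M : Mesh Ω) (T : Finset (Pt d)) : Set (Pt d) :=
  ⋃ K ∈ {K | K ∈ M.elements ∧ (cell K ∩ cell T).Nonempty}, cell K

/-- The value at `x` of a real polynomial in `d` variables. -/
def pEval {d : ℕ} (p : MvPolynomial (Fin d) ℝ) (x : Pt d) : ℝ := MvPolynomial.eval (fun i => x i) p

/-- The space `Q_H^k` of piecewise polynomials of degree at most `k`. -/
def QSpace {d : ℕ} {Ω : Set (Pt d)} (M : Mesh Ω) (k : ℕ) : Submodule ℝ (L2 Ω) where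
  carrier := {q | ∀ T ∈ M.elements, ∃ p : MvPolynomial (Fin d) ℝ, p.totalDegree ≤ k ∧
    ∀ᵐ x ∂(volume.restrict Ω), x ∈ cell T → q x = pEval p x}
  zero_mem' := fun T _ => ⟨0, by simp, by
    filter_upwards [Lp.coeFn_zero ℝ 2 (volume.restrict Ω)] with x hx _
    rw [hx]; simp [pEval]⟩
  add_mem' := by
    intro q r hq hr T hT
    obtain ⟨p, hp, hpq⟩ := hq T hT
    obtain ⟨s, hs, hsr⟩ := hr T hT
    refine ⟨p + s, (MvPolynomial.totalDegree_add p s).trans (max_le hp hs), ?_⟩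
    filter_upwards [hpq, hsr, Lp.coeFn_add q r] with x h1 h2 h3 hx
    rw [h3, Pi.add_apply, h1 hx, h2 hx]
    simp [pEval]
  smul_mem' := by
    intro c q hq T hT
    obtain ⟨p, hp, hpq⟩ := hq T hT
    refine ⟨c • p, (MvPolynomial.totalDegree_smul_le c p).trans hp, ?_⟩
    filter_upwards [hpq, Lp.coeFn_smul c q] with x h1 h3 hx
    simp [h3, h1 hx, pEval]

/-- The set `Q_H^k ∩ L²₀(Ω)`. -/
def QSpace0 {d : ℕ} {Ω : Set (Pt d)} (M : Mesh Ω) (k : ℕ) : Set (L2 Ω) :=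
  {q | q ∈ QSpace M k ∧ ZeroMean Ω q}

/-- The piecewise Raviart-Thomas space: on each element `T` the field is
`x ↦ (p₁(x), …, p_d(x)) + r(x) x` with polynomials `p_i`, `r` of degree at most `k`. -/
def RTSpace {d : ℕ} {Ω : Set (Pt d)} (M : Mesh Ω) (k : ℕ) : Submodule ℝ (L2v Ω) where
  carrier := {v | ∀ T ∈ M.elements, ∃ (p : Fin d → MvPolynomial (Fin d) ℝ)
    (r : MvPolynomial (Fin d) ℝ), (∀ i, (p i).totalDegree ≤ k) ∧ r.totalDegree ≤ k ∧
    ∀ᵐ x ∂(volume.restrict Ω), x ∈ cell T → ∀ i, v x i = pEval (p i) x + x i * pEval r x}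
  zero_mem' := fun T _ => ⟨0, 0, by simp, by simp, by
    filter_upwards [Lp.coeFn_zero (Pt d) 2 (volume.restrict Ω)] with x hx _ i
    rw [hx]; simp [pEval]⟩
  add_mem' := by
    intro v w hv hw T hT
    obtain ⟨p, r, hp, hr, h⟩ := hv T hT
    obtain ⟨p', r', hp', hr', h'⟩ := hw T hT
    refine ⟨p + p', r + r',
      fun i => (MvPolynomial.totalDegree_add _ _).trans (max_le (hp i) (hp' i)),
      (MvPolynomial.totalDegree_add _ _).trans (max_le hr hr'), ?_⟩
    filter_upwards [h, h', Lp.coeFn_add v w] with x h1 h2 h3 hx i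
    rw [h3, Pi.add_apply, PiLp.add_apply, h1 hx, h2 hx]
    simp only [pEval, Pi.add_apply, map_add]
    ring
  smul_mem' := by
    intro c v hv T hT
    obtain ⟨p, r, hp, hr, h⟩ := hv T hT
    refine ⟨c • p, c • r, fun i => (MvPolynomial.totalDegree_smul_le _ _).trans (hp i),
      (MvPolynomial.totalDegree_smul_le _ _).trans hr, ?_⟩
    filter_upwards [h, Lp.coeFn_smul c v] with x h1 h3 hx i
    simp [h3, h1 hx, pEval]
    ring

/-- The Raviart-Thomas finite element space `V_H^k` with vanishing normal trace. -/
def VSpace {d : ℕ} {Ω : Set (Pt d)} (M : Mesh Ω) (k : ℕ) : Submodule ℝ (L2v Ω) :=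
  RTSpace M k ⊓ H0div Ω

/-- The inclusion of `V_H^k` into `H₀(div, Ω)`. -/
def VSpace.incl {d : ℕ} {Ω : Set (Pt d)} (M : Mesh Ω) (k : ℕ) : VSpace M k →ₗ[ℝ] H0div Ω :=
  Submodule.inclusion inf_le_right

/-! ### Stable quasi-interpolation -/

/-- `h` is the `L²`-orthogonal projection of `g` onto `Q`. -/
def IsL2Projection {d : ℕ} {Ω : Set (Pt d)} (Q : Submodule ℝ (L2 Ω)) (g h : L2 Ω) : Prop :=
  h ∈ Q ∧ ∀ q ∈ Q, inner ℝ (g - h) q = 0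

/-- `‖u‖²_{L²(S)} + H² ‖div u‖²_{L²(S)}`, where `H` is the mesh size. -/
def Mesh.localEnergy {d : ℕ} {Ω : Set (Pt d)} (M : Mesh Ω) (S : Set (Pt d)) (u : L2v Ω) : ℝ :=
  (∫ x in S, ‖u x‖ ^ 2 ∂(volume.restrict Ω)) +
    M.size ^ 2 * ∫ x in S, (weakDiv Ω u x) ^ 2 ∂(volume.restrict Ω)

/-- The requirements on the quasi-interpolation operator `π_H : H₀(div, Ω) → V_H^k`: local
stability, the projection property, and the commuting property `div π_H v = P_H div v`. -/
structure IsQuasiInterpolation {d : ℕ} {Ω : Set (Pt d)} (M : Mesh Ω) (k : ℕ)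
    (π : H0div Ω →ₗ[ℝ] VSpace M k) : Prop where
  stable : ∃ C : ℝ, 0 < C ∧ ∀ v : H0div Ω, ∀ T ∈ M.elements,
    M.localEnergy (cell T) (π v : L2v Ω) ≤ C * M.localEnergy (M.patch T) (v : L2v Ω)
  surjective : Function.Surjective π
  idempotent : ∀ v, π (VSpace.incl M k (π v)) = π v
  commuting : ∀ v : H0div Ω,
    IsL2Projection (QSpace M k) (weakDiv Ω (v : L2v Ω)) (weakDiv Ω (π v : L2v Ω))

/-- `W_{div 0}`, the kernel of `π_H` restricted to the divergence-free fields of `H₀(div, Ω)`. -/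
def WDiv0 {d : ℕ} {Ω : Set (Pt d)} {M : Mesh Ω} {k : ℕ} (π : H0div Ω →ₗ[ℝ] VSpace M k) :
    Set (L2v Ω) :=
  {w | ∃ h : w ∈ H0div Ω, weakDiv Ω w = 0 ∧ π ⟨w, h⟩ = 0}

/-! ### Correctors, the ideal multiscale space and the ideal multiscale problem -/

/-- `c = 𝒞_T v`: `c ∈ W_{div 0}` and `a(c, w) = a_T(v, w)` for all `w ∈ W_{div 0}`. -/
def IsElementCorrector {d : ℕ} {Ω : Set (Pt d)} {M : Mesh Ω} {k : ℕ}
    (A : Pt d → Matrix (Fin d) (Fin d) ℝ) (π : H0div Ω →ₗ[ℝ] VSpace M k)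
    (T : Finset (Pt d)) (v c : L2v Ω) : Prop :=
  c ∈ WDiv0 π ∧ ∀ w ∈ WDiv0 π, formA A c w = formAOn A (cell T) v w

open Classical in
/-- The ideal element corrector `𝒞_T v`. -/
def elementCorrector {d : ℕ} {Ω : Set (Pt d)} {M : Mesh Ω} {k : ℕ}
    (A : Pt d → Matrix (Fin d) (Fin d) ℝ) (π : H0div Ω →ₗ[ℝ] VSpace M k)
    (T : Finset (Pt d)) (v : L2v Ω) : L2v Ω :=
  if h : ∃ c, IsElementCorrector A π T v c then h.choose else 0

/-- The ideal global corrector `𝒞 = ∑_T 𝒞_T`. -/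
def corrector {d : ℕ} {Ω : Set (Pt d)} {M : Mesh Ω} {k : ℕ}
    (A : Pt d → Matrix (Fin d) (Fin d) ℝ) (π : H0div Ω →ₗ[ℝ] VSpace M k) (v : L2v Ω) : L2v Ω :=
  ∑ T ∈ M.elements, elementCorrector A π T v

/-- The ideal multiscale space `V_H^{k,ms} = (id - 𝒞) V_H^k`. -/
def VMs {d : ℕ} {Ω : Set (Pt d)} {M : Mesh Ω} {k : ℕ}
    (A : Pt d → Matrix (Fin d) (Fin d) ℝ) (π : H0div Ω →ₗ[ℝ] VSpace M k) : Set (L2v Ω) :=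
  (fun v => v - corrector A π v) '' (VSpace M k : Set (L2v Ω))

/-- `(u, p) ∈ V_H^{k,ms} × (Q_H^k ∩ L²₀(Ω))` solves the ideal multiscale problem with source
`f`. -/
structure IsIdealSolution {d : ℕ} {Ω : Set (Pt d)} {M : Mesh Ω} {k : ℕ}
    (A : Pt d → Matrix (Fin d) (Fin d) ℝ) (π : H0div Ω →ₗ[ℝ] VSpace M k) (f : L2 Ω)
    (u : L2v Ω) (p : L2 Ω) : Prop where
  mem_velocity : u ∈ VMs A π
  mem_pressure : p ∈ QSpace0 M k
  momentum : ∀ v ∈ VMs A π, formA A u v + formB v p = 0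
  mass : ∀ q ∈ QSpace M k, formB u q = - inner ℝ f q

end

end MixedLOD

open MixedLOD

namespace MixedLOD

/-! The cells cover `Ω` and overlap only in null sets, so the local right-hand sides add up to `a(v,
·)` and the global corrector `𝒞` is the `a`-orthogonal projection onto `W = W_{div 0}`
(`formA_corrector`). For the correctors to exist, `W` must be closed in `L²`, although `π` is not
assumed continuous there. On divergence-free fields, however, the divergence term on the right of
the local stability estimate vanishes, and summation over cells gives an `L²` bound for `π`.
Coercivity and boundedness of `a` yield `‖𝒞 v‖ ≤ α⁻¹ β ‖v‖`. Since `div 𝒞 v = 0`, replacing `v` by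
`v - 𝒞 v` keeps `b(v, q)` and enlarges the norm by at most `1 + α⁻¹ β`; this is the transfer of the
inf-sup constant (`le_supQuot_VMs`).

The classical inf-sup constant needs no elliptic regularity. A mean-free discrete `z` orthogonal to
`div V_H^k` is, by the commuting property, orthogonal to `div H₀(div)`. Its weak gradient therefore
vanishes, so it is constant on the connected set `Ω`, hence zero. Thus the divergence is onto `Q_H^k
∩ L²₀` (`exists_weakDiv_eq`), and a linear right inverse on this finite-dimensional space is
automatically bounded.

Well-posedness rests on `mem_VMs_iff`: the multiscale fields are those with discrete divergence that
are `a`-orthogonal to `W`. Subtracting from a lift of `-P_H f` its `a`-projection onto all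
divergence-free fields gives such a field `u`. The functional `a(u, ·)` on `H₀(div)` depends only on
the divergence, and the pressure is its Riesz representative. The difference of two solutions has a
divergence-free velocity of zero energy, and surjectivity of the divergence settles the pressure. -/

variable {d : ℕ} {Ω : Set (Pt d)}

/-! ### Mesh cells: covering and null overlaps -/

theorem isCompact_cell (T : Finset (Pt d)) : IsCompact (cell T) :=
  T.finite_toSet.isCompact_convexHull (𝕜 := ℝ)

theorem measurableSet_cell (T : Finset (Pt d)) : MeasurableSet (cell T) :=
  (isCompact_cell T).measurableSet

/-- The convex hull of at most `d` points of `ℝ^d` is a null set. -/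
theorem volume_convexHull_eq_zero {s : Finset (Pt d)} (hs : s.card < d + 1) :
    volume (convexHull ℝ (s : Set (Pt d))) = 0 := by
  refine measure_mono_null (convexHull_subset_affineSpan _)
    (Measure.addHaar_affineSubspace volume _ fun htop => ?_)
  -- The empty set is split off because the dimension bound `s.card - 1` uses truncated subtraction.
  rcases s.eq_empty_or_nonempty with rfl | hne
  · have : (affineSpan ℝ ((∅ : Finset (Pt d)) : Set (Pt d))) = ⊥ := by simp
    rw [this] at htop
    exact bot_ne_top htop
  · have h1 := finrank_vectorSpan_image_finset_le ℝ (id : Pt d → Pt d) s (n := s.card - 1)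
      (by have := hne.card_pos; omega)
    rw [Finset.image_id] at h1
    rw [← direction_affineSpan, htop, AffineSubspace.direction_top, finrank_top,
      finrank_euclideanSpace_fin] at h1
    have := hne.card_pos
    omega

/-- By conformity the intersection is spanned by the common vertices, and two distinct simplices
share fewer than `d + 1` of them. -/
theorem Mesh.aedisjoint_cell (M : Mesh Ω) {T T' : Finset (Pt d)} (hT : T ∈ M.elements)
    (hT' : T' ∈ M.elements) (hne : T ≠ T') : AEDisjoint volume (cell T) (cell T') := by
  classical
  rw [AEDisjoint, cell, cell, M.conforming T hT T' hT', ← Finset.coe_inter]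
  refine volume_convexHull_eq_zero ?_
  rw [← M.card_eq T hT]
  refine Finset.card_lt_card (Finset.ssubset_iff_subset_ne.2 ⟨Finset.inter_subset_left, fun h => ?_⟩)
  refine hne (Finset.eq_of_subset_of_card_le (Finset.inter_eq_left.1 h) ?_)
  rw [M.card_eq T hT, M.card_eq T' hT']

theorem Mesh.exists_mem_cell (M : Mesh Ω) {x : Pt d} (hx : x ∈ Ω) :
    ∃ T ∈ M.elements, x ∈ cell T := by
  have : x ∈ ⋃ T ∈ M.elements, convexHull ℝ (T : Set (Pt d)) := by
    rw [M.covers]; exact subset_closure hx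
  simpa [cell] using this

/-- The integral over `Ω` is the sum of the integrals over the mesh elements. -/
theorem Mesh.sum_setIntegral_cell (M : Mesh Ω) {f : Pt d → ℝ}
    (hf : Integrable f (volume.restrict Ω)) :
    ∑ T ∈ M.elements, ∫ x in cell T, f x ∂(volume.restrict Ω) = ∫ x in Ω, f x := by
  have h := hasSum_integral_iUnion_ae (μ := volume.restrict Ω) (f := f)
    (s := fun T : M.elements => cell T.1)
    (fun T => (measurableSet_cell T.1).nullMeasurableSet)
    (fun T T' hne => Measure.restrict_le_self.absolutelyContinuous
      (M.aedisjoint_cell T.2 T'.2 (fun h => hne (Subtype.ext h))))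
    hf.integrableOn
  rw [← Finset.sum_coe_sort, ← tsum_fintype (L := .unconditional _), h.tsum_eq]
  have hu : (volume.restrict Ω).restrict (⋃ T : M.elements, cell T.1) = volume.restrict Ω := by
    rw [Measure.restrict_restrict
      (MeasurableSet.iUnion fun T : M.elements => measurableSet_cell T.1), Set.inter_eq_right.2]
    intro x hx
    obtain ⟨T, hT, hxT⟩ := M.exists_mem_cell hx
    exact Set.mem_iUnion.2 ⟨⟨T, hT⟩, hxT⟩
  rw [hu]

/-! ### The weighted bilinear forms -/

section Form

variable {A : Pt d → Matrix (Fin d) (Fin d) ℝ} {α β : ℝ}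

theorem dotProduct_ofLp_self (u : Pt d) : u.ofLp ⬝ᵥ u.ofLp = ‖u‖ ^ 2 := by
  rw [EuclideanSpace.real_norm_sq_eq]
  simp [dotProduct, sq]

theorem IsCoefficient.lower (hA : IsCoefficient Ω A α β) : ∀ᵐ x ∂(volume.restrict Ω),
    ∀ u : Pt d, α * ‖u‖ ^ 2 ≤ ((A x)⁻¹).mulVec u.ofLp ⬝ᵥ u.ofLp := by
  filter_upwards [hA.bounds] with x hx u
  by_cases hu : u = 0
  · simp [hu]
  have h := (hx u.ofLp (by simpa using hu)).1
  rw [dotProduct_ofLp_self, le_div_iff₀ (by positivity)] at h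
  exact h

theorem IsCoefficient.upper_self (hA : IsCoefficient Ω A α β) : ∀ᵐ x ∂(volume.restrict Ω),
    ∀ u : Pt d, ((A x)⁻¹).mulVec u.ofLp ⬝ᵥ u.ofLp ≤ β * ‖u‖ ^ 2 := by
  filter_upwards [hA.bounds] with x hx u
  by_cases hu : u = 0
  · simp [hu]
  have h := (hx u.ofLp (by simpa using hu)).2
  rw [dotProduct_ofLp_self, div_le_iff₀ (by positivity)] at h
  exact h

theorem IsCoefficient.symm (hA : IsCoefficient Ω A α β) : ∀ᵐ x ∂(volume.restrict Ω),
    ∀ u v : Pt d, ((A x)⁻¹).mulVec u.ofLp ⬝ᵥ v.ofLp = ((A x)⁻¹).mulVec v.ofLp ⬝ᵥ u.ofLp := by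
  filter_upwards [hA.posDef] with x hx u v
  have h : ((A x)⁻¹).transpose = (A x)⁻¹ := by
    have := hx.inv.isHermitian
    rwa [Matrix.IsHermitian, Matrix.conjTranspose_eq_transpose_of_trivial] at this
  rw [dotProduct_comm, Matrix.dotProduct_mulVec, ← Matrix.mulVec_transpose, h]

/-- Pointwise boundedness of the coefficient form with the sharp constant `β`. -/
theorem IsCoefficient.upper (hA : IsCoefficient Ω A α β) (hβ : 0 ≤ β) :
    ∀ᵐ x ∂(volume.restrict Ω),
      ∀ u v : Pt d, |((A x)⁻¹).mulVec u.ofLp ⬝ᵥ v.ofLp| ≤ β * ‖u‖ * ‖v‖ := by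
  filter_upwards [hA.lower, hA.upper_self, hA.symm] with x h1 h2 h3 u v
  -- Cauchy–Schwarz for this symmetric positive semidefinite form reduces the mixed bound to the two
  -- diagonal ones.
  let B : LinearMap.BilinForm ℝ (Pt d) := LinearMap.mk₂ ℝ
    (fun u v : Pt d => ((A x)⁻¹).mulVec u.ofLp ⬝ᵥ v.ofLp)
    (fun _ _ _ => by simp [Matrix.mulVec_add]) (fun _ _ _ => by simp [Matrix.mulVec_smul])
    (fun _ _ _ => by simp) (fun _ _ _ => by simp)
  have hB := B.apply_sq_le_of_symm
    (fun u => (mul_nonneg hA.alpha_pos.le (sq_nonneg _)).trans (h1 u)) ⟨fun u v => h3 u v⟩ u v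
  change (((A x)⁻¹).mulVec u.ofLp ⬝ᵥ v.ofLp) ^ 2 ≤
    (((A x)⁻¹).mulVec u.ofLp ⬝ᵥ u.ofLp) * (((A x)⁻¹).mulVec v.ofLp ⬝ᵥ v.ofLp) at hB
  refine abs_le_of_sq_le_sq (hB.trans ?_) (by positivity)
  calc _ ≤ (β * ‖u‖ ^ 2) * (β * ‖v‖ ^ 2) :=
        mul_le_mul (h2 u) (h2 v) ((mul_nonneg hA.alpha_pos.le (sq_nonneg _)).trans (h1 v))
          (by positivity)
    _ = _ := by ring

/-- Supplies the sign of `β`, which is not part of `IsCoefficient`; it needs one point of `Ω` and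
one nonzero vector. -/
theorem IsCoefficient.alpha_le_beta (hA : IsCoefficient Ω A α β) (hd : 0 < d)
    (hΩ : volume Ω ≠ 0) : α ≤ β := by
  have : (ae (volume.restrict Ω)).NeBot := by
    rw [ae_neBot]; simpa using hΩ
  obtain ⟨x, hx⟩ := hA.bounds.exists
  have h := hx (Pi.single ⟨0, hd⟩ 1) (by simp)
  exact h.1.trans h.2

/-- Cramer's rule: determinant and adjugate are polynomial in the entries, and real inversion is
measurable, with value `0` at `0`. -/
theorem IsCoefficient.aestronglyMeasurable_inv (hA : IsCoefficient Ω A α β) (i j : Fin d) :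
    AEStronglyMeasurable (fun x => (A x)⁻¹ i j) (volume.restrict Ω) := by
  have hA' : AEMeasurable (fun x i j => A x i j) (volume.restrict Ω) :=
    aemeasurable_pi_lambda _ fun i => aemeasurable_pi_lambda _ fun j =>
      (hA.memLp_top i j).aestronglyMeasurable.aemeasurable
  have hdet : Continuous fun B : Fin d → Fin d → ℝ => (Matrix.of B).det :=
    Continuous.matrix_det (R := ℝ) continuous_id
  have hadj : Continuous fun B : Fin d → Fin d → ℝ => (Matrix.of B).adjugate i j :=
    (Continuous.matrix_adjugate (R := ℝ) continuous_id).matrix_elem i j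
  have h := (hdet.measurable.inv.mul hadj.measurable).comp_aemeasurable hA'
  refine (h.congr (Filter.Eventually.of_forall fun x => ?_)).aestronglyMeasurable
  simp only [Function.comp, Pi.mul_apply, Pi.inv_apply, Matrix.inv_def, Ring.inverse_eq_inv',
    Matrix.smul_apply, smul_eq_mul]
  rfl

theorem IsCoefficient.integrable (hA : IsCoefficient Ω A α β) (hβ : 0 ≤ β) (u v : L2v Ω) :
    Integrable (fun x => ((A x)⁻¹).mulVec (u x).ofLp ⬝ᵥ (v x).ofLp) (volume.restrict Ω) := by
  have h1 : Integrable (fun x => ‖u x‖ * ‖v x‖) (volume.restrict Ω) :=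
    (Lp.memLp u).norm.integrable_mul (Lp.memLp v).norm
  refine (h1.const_mul β).mono' ?_ ?_
  · have hc : ∀ (w : L2v Ω) (i : Fin d),
        AEStronglyMeasurable (fun x => (w x).ofLp i) (volume.restrict Ω) := fun w i =>
      (EuclideanSpace.proj (𝕜 := ℝ) i).continuous.comp_aestronglyMeasurable
        (Lp.aestronglyMeasurable w)
    simp only [dotProduct, Matrix.mulVec]
    exact Finset.aestronglyMeasurable_fun_sum _ fun i _ =>
      (Finset.aestronglyMeasurable_fun_sum _ fun j _ =>
        (hA.aestronglyMeasurable_inv i j).mul (hc u j)).mul (hc v i)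
  · filter_upwards [hA.upper hβ] with x hx
    simpa [mul_assoc] using hx (u x) (v x)

/-- Cauchy–Schwarz in the scalar space `L²(Ω)` for the pointwise norms. -/
theorem integral_norm_mul_norm_le (u v : L2v Ω) :
    ∫ x in Ω, ‖u x‖ * ‖v x‖ ≤ ‖u‖ * ‖v‖ := by
  have key : ∀ w : L2v Ω, ∃ w' : L2 Ω, ‖w'‖ = ‖w‖ ∧ w' =ᵐ[volume.restrict Ω] fun x => ‖w x‖ :=
    fun w => ⟨(Lp.memLp w).norm.toLp, by
      rw [Lp.norm_toLp, eLpNorm_norm, Lp.norm_def], MemLp.coeFn_toLp _⟩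
  obtain ⟨u', hu, hu'⟩ := key u
  obtain ⟨v', hv, hv'⟩ := key v
  have h := real_inner_le_norm u' v'
  rw [L2.inner_def, hu, hv] at h
  refine le_of_eq_of_le (integral_congr_ae ?_) h
  filter_upwards [hu', hv'] with x h1 h2
  simp [h1, h2, mul_comm]

theorem abs_formAOn_le (hA : IsCoefficient Ω A α β) (hβ : 0 ≤ β) (S : Set (Pt d))
    (u v : L2v Ω) : |formAOn A S u v| ≤ β * ‖u‖ * ‖v‖ := by
  have h1 : Integrable (fun x => ‖u x‖ * ‖v x‖) (volume.restrict Ω) :=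
    (Lp.memLp u).norm.integrable_mul (Lp.memLp v).norm
  rw [formAOn, mul_assoc, ← Real.norm_eq_abs]
  calc _ ≤ ∫ x in S, β * (‖u x‖ * ‖v x‖) ∂(volume.restrict Ω) := by
        refine norm_integral_le_of_norm_le (h1.const_mul β).integrableOn (ae_restrict_of_ae ?_)
        filter_upwards [hA.upper hβ] with x hx
        simpa [mul_assoc] using hx (u x) (v x)
    _ ≤ ∫ x in Ω, β * (‖u x‖ * ‖v x‖) :=
        setIntegral_le_integral (h1.const_mul β)
          (Filter.Eventually.of_forall fun x => by positivity)
    _ ≤ _ := by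
        rw [integral_const_mul]
        exact mul_le_mul_of_nonneg_left (integral_norm_mul_norm_le u v) hβ

/-- The weighted form `(A⁻¹ u, v)_{L²(S ∩ Ω)}` as a continuous bilinear form. -/
noncomputable def formAOnL (hA : IsCoefficient Ω A α β) (hβ : 0 ≤ β) (S : Set (Pt d)) :
    L2v Ω →L[ℝ] L2v Ω →L[ℝ] ℝ :=
  LinearMap.mkContinuous₂
    (LinearMap.mk₂ ℝ (formAOn A S)
      (fun u u' v => by
        rw [formAOn, formAOn, formAOn,
          ← integral_add (hA.integrable hβ u v).integrableOn (hA.integrable hβ u' v).integrableOn]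
        refine integral_congr_ae (ae_restrict_of_ae ?_)
        filter_upwards [Lp.coeFn_add u u'] with x hx
        rw [hx]; simp [Matrix.mulVec_add])
      (fun c u v => by
        rw [formAOn, formAOn, smul_eq_mul, ← integral_const_mul]
        refine integral_congr_ae (ae_restrict_of_ae ?_)
        filter_upwards [Lp.coeFn_smul c u] with x hx
        rw [hx]; simp [Matrix.mulVec_smul])
      (fun u v v' => by
        rw [formAOn, formAOn, formAOn,
          ← integral_add (hA.integrable hβ u v).integrableOn (hA.integrable hβ u v').integrableOn]
        refine integral_congr_ae (ae_restrict_of_ae ?_)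
        filter_upwards [Lp.coeFn_add v v'] with x hx
        rw [hx]; simp)
      (fun c u v => by
        rw [formAOn, formAOn, smul_eq_mul, ← integral_const_mul]
        refine integral_congr_ae (ae_restrict_of_ae ?_)
        filter_upwards [Lp.coeFn_smul c v] with x hx
        rw [hx]; simp))
    β (fun u v => abs_formAOn_le hA hβ S u v)

theorem formAOnL_apply (hA : IsCoefficient Ω A α β) (hβ : 0 ≤ β) (S : Set (Pt d)) (u v : L2v Ω) :
    formAOnL hA hβ S u v = formAOn A S u v := rfl

/-- The weighted form `a` as a continuous bilinear form. -/
noncomputable def formAL (hA : IsCoefficient Ω A α β) (hβ : 0 ≤ β) :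
    L2v Ω →L[ℝ] L2v Ω →L[ℝ] ℝ := formAOnL hA hβ Set.univ

theorem formAL_apply (hA : IsCoefficient Ω A α β) (hβ : 0 ≤ β) (u v : L2v Ω) :
    formAL hA hβ u v = formA A u v := by
  rw [formAL, formAOnL_apply, formAOn, formA, Measure.restrict_univ]

theorem formA_le (hA : IsCoefficient Ω A α β) (hβ : 0 ≤ β) (u v : L2v Ω) :
    formA A u v ≤ β * ‖u‖ * ‖v‖ := by
  rw [← formAL_apply hA hβ]
  exact (le_abs_self _).trans (abs_formAOn_le hA hβ Set.univ u v)

theorem norm_sq_eq_integral (u : L2v Ω) : ‖u‖ ^ 2 = ∫ x in Ω, ‖u x‖ ^ 2 := by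
  rw [← real_inner_self_eq_norm_sq, L2.inner_def]
  simp

theorem integrable_norm_sq (u : L2v Ω) :
    Integrable (fun x => ‖u x‖ ^ 2) (volume.restrict Ω) :=
  (Lp.memLp u).integrable_norm_pow (p := 2) (by norm_num)

theorem le_formA (hA : IsCoefficient Ω A α β) (hβ : 0 ≤ β) (u : L2v Ω) :
    α * ‖u‖ ^ 2 ≤ formA A u u := by
  rw [norm_sq_eq_integral, ← integral_const_mul]
  refine integral_mono_ae ((integrable_norm_sq u).const_mul α) (hA.integrable hβ u u) ?_
  filter_upwards [hA.lower] with x hx using hx _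

theorem eq_zero_of_formA_self (hA : IsCoefficient Ω A α β) (hβ : 0 ≤ β) {u : L2v Ω}
    (h : formA A u u = 0) : u = 0 := by
  have h1 := le_formA hA hβ u
  rw [h] at h1
  have h2 : ‖u‖ ^ 2 ≤ 0 := nonpos_of_mul_nonpos_right h1 hA.alpha_pos
  simpa using h2

theorem sum_formAOn_cell (hA : IsCoefficient Ω A α β) (hβ : 0 ≤ β)
    (M : Mesh Ω) (u v : L2v Ω) :
    ∑ T ∈ M.elements, formAOn A (cell T) u v = formA A u v :=
  M.sum_setIntegral_cell (hA.integrable hβ u v)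

/-- Continuous functionals are represented by the weighted form on closed subspaces. -/
theorem exists_formA_eq (hA : IsCoefficient Ω A α β) (hβ : 0 ≤ β) {K : Submodule ℝ (L2v Ω)}
    (hK : IsClosed (K : Set (L2v Ω))) (ℓ : L2v Ω →L[ℝ] ℝ) :
    ∃ c ∈ K, ∀ w ∈ K, formA A c w = ℓ w := by
  have : CompleteSpace K := hK.completeSpace_coe
  let B : K →L[ℝ] K →L[ℝ] ℝ := (formAL hA hβ).bilinearComp K.subtypeL K.subtypeL
  have hB : IsCoercive B := ⟨α, hA.alpha_pos, fun u => by
    have := le_formA hA hβ u.1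
    simp only [B, ContinuousLinearMap.bilinearComp_apply, formAL_apply, Submodule.subtypeL_apply]
    rw [sq, ← mul_assoc] at this
    exact this⟩
  -- Lax–Milgram: `f` is the Riesz representative of the functional, and `c` solves `B c = f`.
  let f : K := (InnerProductSpace.toDual ℝ K).symm (ℓ.comp K.subtypeL)
  let c : K := hB.continuousLinearEquivOfBilin.symm f
  refine ⟨c, c.2, fun w hw => ?_⟩
  have h1 := hB.continuousLinearEquivOfBilin_apply c ⟨w, hw⟩
  have h2 : inner ℝ f (⟨w, hw⟩ : K) = ℓ w := by
    simp [f]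
  rw [ContinuousLinearEquiv.apply_symm_apply, h2] at h1
  rw [h1, ← formAL_apply hA hβ]
  rfl

end Form

/-! ### The divergence as a linear map; closedness of the divergence-free fields -/

theorem NormalTraceZero.hasWeakDiv {u : L2v Ω} {g : L2 Ω} (h : NormalTraceZero Ω u g) :
    HasWeakDiv Ω u g := fun φ hφ _ => eq_neg_of_add_eq_zero_left (h φ hφ)

theorem NormalTraceZero.mem_H0div {u : L2v Ω} {g : L2 Ω} (h : NormalTraceZero Ω u g) :
    u ∈ H0div Ω := ⟨g, h.hasWeakDiv, h⟩

theorem NormalTraceZero.weakDiv_eq (hΩ : IsOpen Ω) {u : L2v Ω} {g : L2 Ω}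
    (h : NormalTraceZero Ω u g) : weakDiv Ω u = g := h.hasWeakDiv.weakDiv_eq hΩ

theorem normalTraceZero_weakDiv (hΩ : IsOpen Ω) {u : L2v Ω} (hu : u ∈ H0div Ω) :
    NormalTraceZero Ω u (weakDiv Ω u) := by
  obtain ⟨g, -, hg⟩ := hu
  rwa [hg.weakDiv_eq hΩ]

/-- The weak divergence as a linear map on `H₀(div, Ω)`. -/
noncomputable def divL (hΩ : IsOpen Ω) : H0div Ω →ₗ[ℝ] L2 Ω where
  toFun u := weakDiv Ω (u : L2v Ω)
  map_add' u v := by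
    refine NormalTraceZero.weakDiv_eq hΩ fun φ hφ => ?_
    rw [Submodule.coe_add, integral_fderiv_add _ _ hφ, integral_mul_test_add _ _ hφ]
    linarith [normalTraceZero_weakDiv hΩ u.2 φ hφ, normalTraceZero_weakDiv hΩ v.2 φ hφ]
  map_smul' c u := by
    refine NormalTraceZero.weakDiv_eq hΩ fun φ hφ => ?_
    rw [Submodule.coe_smul, integral_fderiv_smul, RingHom.id_apply, integral_mul_test_smul,
      ← mul_add, normalTraceZero_weakDiv hΩ u.2 φ hφ, mul_zero]

theorem divL_apply (hΩ : IsOpen Ω) (u : H0div Ω) : divL hΩ u = weakDiv Ω (u : L2v Ω) := rfl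

theorem weakDiv_sub (hΩ : IsOpen Ω) {u v : L2v Ω} (hu : u ∈ H0div Ω) (hv : v ∈ H0div Ω) :
    weakDiv Ω (u - v) = weakDiv Ω u - weakDiv Ω v := (divL hΩ).map_sub ⟨u, hu⟩ ⟨v, hv⟩

theorem weakDiv_zero (hΩ : IsOpen Ω) : weakDiv Ω (0 : L2v Ω) = 0 := (divL hΩ).map_zero

/-- The divergence-free fields of `H₀(div, Ω)`. -/
noncomputable def divFree (hΩ : IsOpen Ω) : Submodule ℝ (L2v Ω) :=
  (LinearMap.ker (divL hΩ)).map (H0div Ω).subtype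

theorem mem_divFree {hΩ : IsOpen Ω} {u : L2v Ω} :
    u ∈ divFree hΩ ↔ u ∈ H0div Ω ∧ weakDiv Ω u = 0 := by
  simp [divFree, divL_apply, and_comm]

theorem mem_divFree_iff_normalTraceZero {hΩ : IsOpen Ω} {u : L2v Ω} :
    u ∈ divFree hΩ ↔ NormalTraceZero Ω u 0 := by
  rw [mem_divFree]
  refine ⟨fun h => h.2 ▸ normalTraceZero_weakDiv hΩ h.1, fun h => ⟨h.mem_H0div, h.weakDiv_eq hΩ⟩⟩

/-- Exhibits each test condition as an `L²`-continuous functional of the field; used for the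
closedness of `divFree`. -/
theorem exists_inner_eq_integral_fderiv {φ : Pt d → ℝ} (hφ : IsTest φ) :
    ∃ G : L2v Ω, ∀ u : L2v Ω, inner ℝ G u = ∫ x in Ω, fderiv ℝ φ x (u x) := by
  have hc : Continuous (fderiv ℝ φ) := hφ.1.continuous_fderiv (by simp)
  let e := (InnerProductSpace.toDual ℝ (Pt d)).symm
  have h1 : MemLp (fun x => e (fderiv ℝ φ x)) 2 (volume.restrict Ω) :=
    ((e.continuous.comp hc).memLp_of_hasCompactSupport
      ((hφ.2.fderiv (𝕜 := ℝ)).comp_left (map_zero e))).restrict Ω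
  refine ⟨h1.toLp, fun u => ?_⟩
  rw [L2.inner_def]
  refine integral_congr_ae ?_
  filter_upwards [h1.coeFn_toLp] with x hx
  rw [hx]
  simp [e]

/-- With prescribed divergence `0`, weak divergence and normal trace merge into one family of
`L²`-continuous equations. -/
theorem isClosed_divFree (hΩ : IsOpen Ω) : IsClosed (divFree hΩ : Set (L2v Ω)) := by
  have h0 : ∀ φ : Pt d → ℝ, ∫ x in Ω, (0 : L2 Ω) x * φ x = 0 := fun φ => by
    simpa using integral_mul_test_smul (0 : ℝ) (0 : L2 Ω) φ
  have : (divFree hΩ : Set (L2v Ω)) =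
      ⋂ (φ : Pt d → ℝ) (_ : IsTest φ), {u | ∫ x in Ω, fderiv ℝ φ x (u x) = 0} := by
    ext u
    simp only [SetLike.mem_coe, mem_divFree_iff_normalTraceZero, NormalTraceZero, h0, add_zero,
      Set.mem_iInter, Set.mem_ofPred_eq]
  rw [this]
  refine isClosed_iInter fun φ => isClosed_iInter fun hφ => ?_
  obtain ⟨G, hG⟩ := exists_inner_eq_integral_fderiv (Ω := Ω) hφ
  simp only [← hG]
  exact isClosed_eq (continuous_const.inner continuous_id) continuous_const

/-! ### The interpolation operator and its divergence-free kernel -/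

section Interpolation

variable {M : Mesh Ω} {k : ℕ} {π : H0div Ω →ₗ[ℝ] VSpace M k}

theorem IsQuasiInterpolation.apply_of_mem (hπ : IsQuasiInterpolation M k π) {v : L2v Ω}
    (hv : v ∈ VSpace M k) : π ⟨v, hv.2⟩ = ⟨v, hv⟩ := by
  obtain ⟨u, hu⟩ := hπ.surjective ⟨v, hv⟩
  have := hπ.idempotent u
  rw [hu] at this
  exact this

/-- `π` fixes `v`, so the commuting property makes `div v` its own projection onto `Q_H^k`. -/
theorem weakDiv_mem_QSpace (hπ : IsQuasiInterpolation M k π) {v : L2v Ω}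
    (hv : v ∈ VSpace M k) : weakDiv Ω v ∈ QSpace M k := by
  have := (hπ.commuting ⟨v, hv.2⟩).1
  rwa [hπ.apply_of_mem hv] at this

theorem IsL2Projection.eq_of_mem {Q : Submodule ℝ (L2 Ω)} {g h : L2 Ω}
    (H : IsL2Projection Q g h) (hg : g ∈ Q) : h = g := by
  have := H.2 _ (Q.sub_mem hg H.1)
  rw [inner_self_eq_zero, sub_eq_zero] at this
  exact this.symm

theorem IsQuasiInterpolation.weakDiv_apply (hπ : IsQuasiInterpolation M k π) {v : L2v Ω}
    (hv : v ∈ H0div Ω) (hq : weakDiv Ω v ∈ QSpace M k) :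
    weakDiv Ω (π ⟨v, hv⟩ : L2v Ω) = weakDiv Ω v :=
  (hπ.commuting ⟨v, hv⟩).eq_of_mem hq

/-- The interpolation operator is `L²`-bounded on divergence-free fields. -/
theorem IsQuasiInterpolation.exists_norm_le (hπ : IsQuasiInterpolation M k π) :
    ∃ C : ℝ, 0 ≤ C ∧ ∀ v : H0div Ω, weakDiv Ω (v : L2v Ω) = 0 →
      ‖(π v : L2v Ω)‖ ^ 2 ≤ C * ‖(v : L2v Ω)‖ ^ 2 := by
  obtain ⟨C, hC, h⟩ := hπ.stable
  -- Each patch integral is crudely bounded by the full norm, which costs a factor equal to the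
  -- number of elements.
  refine ⟨M.elements.card * C, by positivity, fun v hv => ?_⟩
  have hint : ∀ g : L2v Ω, Integrable (fun x => ‖g x‖ ^ 2) (volume.restrict Ω) :=
    integrable_norm_sq
  rw [norm_sq_eq_integral, ← M.sum_setIntegral_cell (hint _), mul_assoc, ← nsmul_eq_mul]
  refine Finset.sum_le_card_nsmul _ _ _ fun T hT => ?_
  have h1 := h v T hT
  have h2 : ∫ x in M.patch T, (weakDiv Ω (v : L2v Ω) x) ^ 2 ∂(volume.restrict Ω) = 0 := by
    rw [hv]
    refine integral_eq_zero_of_ae (ae_restrict_of_ae ?_)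
    filter_upwards [Lp.coeFn_zero ℝ 2 (volume.restrict Ω)] with x hx
    simp only [hx, Pi.zero_apply, ne_eq, OfNat.ofNat_ne_zero, not_false_eq_true, zero_pow]
  rw [Mesh.localEnergy, Mesh.localEnergy, h2, mul_zero, add_zero] at h1
  have h3 : 0 ≤ M.size ^ 2 * ∫ x in cell T, (weakDiv Ω (π v : L2v Ω) x) ^ 2
      ∂(volume.restrict Ω) :=
    mul_nonneg (sq_nonneg _) (integral_nonneg fun x => sq_nonneg _)
  have h4 : ∫ x in M.patch T, ‖(v : L2v Ω) x‖ ^ 2 ∂(volume.restrict Ω) ≤ ‖(v : L2v Ω)‖ ^ 2 := by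
    rw [norm_sq_eq_integral]
    exact setIntegral_le_integral (hint _) (Filter.Eventually.of_forall fun x => by positivity)
  calc _ ≤ C * ∫ x in M.patch T, ‖(v : L2v Ω) x‖ ^ 2 ∂(volume.restrict Ω) := by linarith
    _ ≤ _ := mul_le_mul_of_nonneg_left h4 hC.le

/-- The space `W_{div 0}` as a submodule. -/
noncomputable def kernelDivFree (hΩ : IsOpen Ω) (π : H0div Ω →ₗ[ℝ] VSpace M k) :
    Submodule ℝ (L2v Ω) :=
  (LinearMap.ker (divL hΩ) ⊓ LinearMap.ker π).map (H0div Ω).subtype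

theorem mem_kernelDivFree {hΩ : IsOpen Ω} {w : L2v Ω} :
    w ∈ kernelDivFree hΩ π ↔ w ∈ WDiv0 π := by
  simp only [kernelDivFree, Submodule.mem_map, Submodule.mem_inf, LinearMap.mem_ker,
    Submodule.subtype_apply, WDiv0, Set.mem_ofPred_eq, divL_apply]
  constructor
  · rintro ⟨y, hy, rfl⟩
    exact ⟨y.2, hy⟩
  · rintro ⟨h, hw⟩
    exact ⟨⟨w, h⟩, hw, rfl⟩

/-- Limits stay divergence-free, and on such fields `π` is `L²`-bounded, so its kernel passes to the
limit as well. -/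
theorem isClosed_kernelDivFree (hπ : IsQuasiInterpolation M k π) (hΩ : IsOpen Ω) :
    IsClosed (kernelDivFree hΩ π : Set (L2v Ω)) := by
  obtain ⟨C, hC, hb⟩ := hπ.exists_norm_le
  have hsub : (kernelDivFree hΩ π : Set (L2v Ω)) ⊆ divFree hΩ := fun w hw => by
    obtain ⟨h, h1, -⟩ := mem_kernelDivFree.1 hw
    exact mem_divFree.2 ⟨h, h1⟩
  refine isClosed_of_closure_subset fun w hw => ?_
  have hwK := mem_divFree.1 ((isClosed_divFree hΩ).closure_subset_iff.2 hsub hw)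
  refine mem_kernelDivFree.2 ⟨hwK.1, hwK.2, ?_⟩
  suffices h : ‖(π ⟨w, hwK.1⟩ : L2v Ω)‖ ^ 2 ≤ 0 by
    have h' : (π ⟨w, hwK.1⟩ : L2v Ω) = 0 := by simpa using h
    exact Subtype.ext h'
  refine le_of_forall_pos_le_add fun ε hε => ?_
  -- The `+ 1` keeps the denominator positive when `C = 0`.
  obtain ⟨w', hw', hd⟩ := Metric.mem_closure_iff.1 hw (Real.sqrt (ε / (C + 1)))
    (Real.sqrt_pos.2 (by positivity))
  obtain ⟨h, h1, h2⟩ := mem_kernelDivFree.1 hw'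
  have h3 := hb (⟨w, hwK.1⟩ - ⟨w', h⟩) (by
    rw [← divL_apply hΩ, map_sub, divL_apply, divL_apply]
    simp [h1, hwK.2])
  rw [map_sub, h2, sub_zero] at h3
  have h4 : ‖w - w'‖ ^ 2 ≤ ε / (C + 1) := by
    rw [← dist_eq_norm, ← Real.sq_sqrt (show 0 ≤ ε / (C + 1) by positivity)]
    exact pow_le_pow_left₀ dist_nonneg hd.le 2
  calc _ ≤ C * ‖w - w'‖ ^ 2 := h3
    _ ≤ C * (ε / (C + 1)) := mul_le_mul_of_nonneg_left h4 hC
    _ ≤ 0 + ε := by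
      rw [zero_add, ← mul_div_assoc, div_le_iff₀ (by positivity)]
      nlinarith

/-! ### Correctors and the multiscale space -/

variable {A : Pt d → Matrix (Fin d) (Fin d) ℝ} {α β : ℝ}

/-- Lax–Milgram on the closed space `W_{div 0}` shows that the default value `0` in the definition
never enters. -/
theorem elementCorrector_spec (hπ : IsQuasiInterpolation M k π) (hΩ : IsOpen Ω)
    (hA : IsCoefficient Ω A α β) (hβ : 0 ≤ β) (T : Finset (Pt d)) (v : L2v Ω) :
    IsElementCorrector A π T v (elementCorrector A π T v) := by
  have h : ∃ c, IsElementCorrector A π T v c := by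
    obtain ⟨c, hc, h⟩ := exists_formA_eq hA hβ (isClosed_kernelDivFree hπ hΩ)
      (formAOnL hA hβ (cell T) v)
    exact ⟨c, mem_kernelDivFree.1 hc, fun w hw => h w (mem_kernelDivFree.2 hw)⟩
  rw [elementCorrector, dif_pos h]
  exact h.choose_spec

theorem corrector_mem (hπ : IsQuasiInterpolation M k π) (hΩ : IsOpen Ω)
    (hA : IsCoefficient Ω A α β) (hβ : 0 ≤ β) (v : L2v Ω) : corrector A π v ∈ WDiv0 π :=
  mem_kernelDivFree.1 (Submodule.sum_mem (kernelDivFree hΩ π) fun T _ =>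
    mem_kernelDivFree.2 (elementCorrector_spec hπ hΩ hA hβ T v).1)

/-- The corrector is the `a`-orthogonal projection onto `W_{div 0}`. -/
theorem formA_corrector (hπ : IsQuasiInterpolation M k π) (hΩ : IsOpen Ω)
    (hA : IsCoefficient Ω A α β) (hβ : 0 ≤ β) (v : L2v Ω) {w : L2v Ω} (hw : w ∈ WDiv0 π) :
    formA A (corrector A π v) w = formA A v w := by
  rw [← sum_formAOn_cell hA hβ M v w, ← formAL_apply hA hβ, corrector, map_sum,
    sum_apply]
  refine Finset.sum_congr rfl fun T _ => ?_
  rw [formAL_apply]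
  exact (elementCorrector_spec hπ hΩ hA hβ T v).2 w hw

/-- Testing with the corrector itself: `α ‖𝒞 v‖² ≤ a(𝒞 v, 𝒞 v) = a(v, 𝒞 v) ≤ β ‖v‖ ‖𝒞 v‖`. -/
theorem norm_corrector_le (hπ : IsQuasiInterpolation M k π) (hΩ : IsOpen Ω)
    (hA : IsCoefficient Ω A α β) (hβ : 0 ≤ β) (v : L2v Ω) :
    ‖corrector A π v‖ ≤ α⁻¹ * β * ‖v‖ := by
  have h1 := le_formA hA hβ (corrector A π v)
  rw [formA_corrector hπ hΩ hA hβ v (corrector_mem hπ hΩ hA hβ v)] at h1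
  have h2 := h1.trans (formA_le hA hβ v (corrector A π v))
  have hα := hA.alpha_pos
  rcases (norm_nonneg (corrector A π v)).eq_or_lt with h | h
  · rw [← h]; positivity
  · have h3 : α * ‖corrector A π v‖ ≤ β * ‖v‖ := by
      refine le_of_mul_le_mul_right ?_ h
      linarith [sq ‖corrector A π v‖]
    rw [mul_assoc, ← div_eq_inv_mul, le_div_iff₀ hα]
    linarith

/-- The multiscale space consists of the fields with discrete divergence that are
`a`-orthogonal to `W_{div 0}`. -/
theorem mem_VMs_iff (hπ : IsQuasiInterpolation M k π) (hΩ : IsOpen Ω)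
    (hA : IsCoefficient Ω A α β) (hβ : 0 ≤ β) {u : L2v Ω} :
    u ∈ VMs A π ↔ u ∈ H0div Ω ∧ weakDiv Ω u ∈ QSpace M k ∧ ∀ w ∈ WDiv0 π, formA A u w = 0 := by
  constructor
  · rintro ⟨v, hv, rfl⟩
    obtain ⟨h1, h2, h3⟩ := corrector_mem hπ hΩ hA hβ v
    refine ⟨(H0div Ω).sub_mem hv.2 h1, ?_, fun w hw => ?_⟩
    · rw [weakDiv_sub hΩ hv.2 h1, h2, sub_zero]
      exact weakDiv_mem_QSpace hπ hv
    · rw [← formAL_apply hA hβ, map_sub, sub_apply, formAL_apply,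
        formAL_apply, formA_corrector hπ hΩ hA hβ v hw, sub_self]
  · rintro ⟨hu, hq, ha⟩
    have hv := (π ⟨u, hu⟩).2
    -- The preimage is `v = π u`. As `div u` is discrete, `div v = div u`, and `π v = v`; hence `u -
    -- v` lies in `W_{div 0}`.
    refine ⟨π ⟨u, hu⟩, hv, ?_⟩
    set v : L2v Ω := (π ⟨u, hu⟩ : L2v Ω) with hvdef
    have hc := corrector_mem hπ hΩ hA hβ v
    have huv : u - v ∈ WDiv0 π := by
      refine ⟨(H0div Ω).sub_mem hu hv.2, ?_, ?_⟩
      · rw [weakDiv_sub hΩ hu hv.2, hπ.weakDiv_apply hu hq, sub_self]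
      · have : (⟨u - v, (H0div Ω).sub_mem hu hv.2⟩ : H0div Ω) = ⟨u, hu⟩ - ⟨v, hv.2⟩ := rfl
        rw [this, map_sub, hπ.apply_of_mem hv, sub_eq_zero]
    have hz : v - corrector A π v - u ∈ WDiv0 π := by
      rw [← mem_kernelDivFree (hΩ := hΩ)] at hc huv ⊢
      have : v - corrector A π v - u = -((u - v) + corrector A π v) := by abel
      rw [this]
      exact neg_mem (add_mem huv hc)
    -- `v - 𝒞 v - u` both lies in `W_{div 0}` and is `a`-orthogonal to it, so its energy vanishes.
    refine sub_eq_zero.1 (eq_zero_of_formA_self hA hβ ?_)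
    have h6 : ∀ z, formA A (v - corrector A π v - u) z =
        formA A v z - formA A (corrector A π v) z - formA A u z := fun z => by
      simp only [← formAL_apply hA hβ, map_sub, sub_apply]
    exact (h6 _).trans (by rw [formA_corrector hπ hΩ hA hβ v hz, ha _ hz]; simp)

end Interpolation

/-! ### Functions with vanishing weak gradient are constant -/

section WeakGradient

open Filter Topology Metric

/-- A function on an open set whose weak gradient vanishes is locally constant: local version on a
ball, by mollification. -/
theorem exists_ae_eq_const_ball {g : Pt d → ℝ} (hg : LocallyIntegrable g volume) {x₀ : Pt d}
    {r : ℝ} (hr : 0 < r)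
    (h : ∀ φ : Pt d → ℝ, IsTest φ → tsupport φ ⊆ ball x₀ (2 * r) →
      ∀ v, ∫ x, fderiv ℝ φ x v * g x = 0) :
    ∃ c : ℝ, ∀ᵐ x, x ∈ ball x₀ r → g x = c := by
  -- The fixed ratio `2` of the radii gives a.e. convergence of the mollifications; outer radius at
  -- most `r` keeps the kernels centred in `ball x₀ r` supported in `ball x₀ (2 * r)`.
  let ψ : ℕ → ContDiffBump (0 : Pt d) := fun n =>
    { rIn := r / (2 * (n + 1)), rOut := r / (n + 1), rIn_pos := by positivity
      rIn_lt_rOut := by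
        have : (0 : ℝ) < n + 1 := by positivity
        exact div_lt_div_of_pos_left hr this (by linarith) }
  have hlim := ContDiffBump.ae_convolution_tendsto_right_of_locallyIntegrable
    (μ := (volume : Measure (Pt d))) (φ := ψ) (l := atTop) (K := 2)
    (by
      have := (tendsto_one_div_add_atTop_nhds_zero_nat (𝕜 := ℝ)).const_mul r
      simpa [ψ, div_eq_mul_inv] using this)
    (Eventually.of_forall fun n => by
      simp only [ψ]; field_simp; rfl) hg
  set F : ℕ → Pt d → ℝ := fun n =>
    convolution ((ψ n).normed volume) g (ContinuousLinearMap.lsmul ℝ ℝ) volume with hF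
  have hsm : ∀ n, ContDiff ℝ ∞ ((ψ n).normed (volume : Measure (Pt d))) := fun n =>
    (ψ n).contDiff_normed
  have hcs : ∀ n, HasCompactSupport ((ψ n).normed (volume : Measure (Pt d))) := fun n =>
    (ψ n).hasCompactSupport_normed
  have hrO : ∀ n, (ψ n).rOut ≤ r := fun n => by
    simp only [ψ]
    exact div_le_self hr.le (by linarith [(Nat.cast_nonneg n : (0 : ℝ) ≤ n)])
  have hder : ∀ n, ∀ x ∈ ball x₀ r, HasFDerivAt (F n) (0 : Pt d →L[ℝ] ℝ) x := by
    intro n x hx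
    have h1 := (hcs n).hasFDerivAt_convolution_left (ContinuousLinearMap.lsmul ℝ ℝ)
      ((hsm n).of_le (by exact_mod_cast le_top)) hg x
    suffices h0 : convolution (fderiv ℝ ((ψ n).normed volume)) g
        ((ContinuousLinearMap.lsmul ℝ ℝ : ℝ →L[ℝ] ℝ →L[ℝ] ℝ).precompL (Pt d)) volume x = 0 by
      rw [h0] at h1; exact h1
    refine ContinuousLinearMap.ext fun v => ?_
    have hex := ((hcs n).fderiv (𝕜 := ℝ)).convolutionExists_left
      ((ContinuousLinearMap.lsmul ℝ ℝ : ℝ →L[ℝ] ℝ →L[ℝ] ℝ).precompL (Pt d))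
      ((hsm n).continuous_fderiv (by simp)) hg x
    rw [convolution_eq_swap, ContinuousLinearMap.integral_apply]
    -- The reflected and translated kernel is an admissible test function; the hypothesis for it
    -- says that the mollification has zero derivative at `x`.
    · let φ : Pt d → ℝ := fun y => (ψ n).normed volume (x - y)
      have hφd : ∀ y w, fderiv ℝ φ y w = - fderiv ℝ ((ψ n).normed volume) (x - y) w := by
        intro y w
        have h2 : HasFDerivAt φ ((fderiv ℝ ((ψ n).normed volume) (x - y)).comp
            (-ContinuousLinearMap.id ℝ (Pt d))) y :=
          ((((hsm n).differentiable (by simp)) (x - y)).hasFDerivAt).comp y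
            ((hasFDerivAt_id y).const_sub x)
        rw [h2.fderiv]; simp
      have hts : tsupport φ ⊆ closedBall x (ψ n).rOut := by
        refine closure_minimal (fun y hy => ?_) isClosed_closedBall
        have : x - y ∈ Function.support ((ψ n).normed (volume : Measure (Pt d))) := hy
        rw [(ψ n).support_normed_eq, mem_ball_zero_iff, ← dist_eq_norm, dist_comm] at this
        exact this.le
      have h3 := h φ ⟨(hsm n).comp (contDiff_const.sub contDiff_id),
        HasCompactSupport.of_support_subset_isCompact (isCompact_closedBall x (ψ n).rOut)
          (subset_closure.trans hts)⟩ (hts.trans fun y hy => by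
            rw [mem_closedBall] at hy
            rw [mem_ball] at hx ⊢
            linarith [dist_triangle y x x₀, hrO n]) v
      simp only [hφd, neg_mul, integral_neg, neg_eq_zero] at h3
      simpa [ContinuousLinearMap.precompL_apply] using h3
    · have := hex
      rw [ConvolutionExistsAt] at this
      have h4 := this.comp_sub_left x
      simpa using h4
  have hconst : ∀ n, ∀ x ∈ ball x₀ r, ∀ y ∈ ball x₀ r, F n x = F n y := by
    intro n x hx y hy
    refine (convex_ball x₀ r).is_const_of_fderivWithin_eq_zero (𝕜 := ℝ)
      (fun z hz => (hder n z hz).differentiableAt.differentiableWithinAt) (fun z hz => ?_) hx hy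
    rw [fderivWithin_of_isOpen isOpen_ball hz, (hder n z hz).fderiv]
  -- Convergence holds a.e. and the ball has positive measure, so it holds at some point; as each `F
  -- n` is constant on the ball, all other limits equal `g x₁`.
  obtain ⟨x₁, hx₁, hx₁l⟩ : ∃ x₁ ∈ ball x₀ r, Tendsto (fun n => F n x₁) atTop (𝓝 (g x₁)) := by
    by_contra! hcon
    have h5 : volume (ball x₀ r) = 0 := by
      refine measure_mono_null (fun x hx => ?_) (ae_iff.1 hlim)
      exact hcon x hx
    exact (measure_ball_pos volume x₀ hr).ne' h5
  refine ⟨g x₁, ?_⟩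
  filter_upwards [hlim] with x hx hxb
  refine tendsto_nhds_unique hx (hx₁l.congr fun n => hconst n x₁ hx₁ x hxb)

/-- A square-integrable function on a bounded connected open set whose weak gradient vanishes is
constant. -/
theorem exists_ae_eq_const (hΩ : IsOpen Ω) (hc : IsConnected Ω) (q : L2 Ω)
    (hb : Bornology.IsBounded Ω)
    (h : ∀ φ : Pt d → ℝ, IsTest φ → tsupport φ ⊆ Ω → ∀ v,
      ∫ x in Ω, fderiv ℝ φ x v * q x = 0) :
    ∃ c : ℝ, ∀ᵐ x ∂(volume.restrict Ω), q x = c := by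
  have : IsFiniteMeasure ((volume : Measure (Pt d)).restrict Ω) :=
    ⟨by simpa using hb.measure_lt_top⟩
  have hq : Integrable q (volume.restrict Ω) := (Lp.memLp q).integrable (by norm_num)
  let g : Pt d → ℝ := Ω.indicator q
  have hg : LocallyIntegrable g volume :=
    ((integrable_indicator_iff hΩ.measurableSet).2 hq).locallyIntegrable
  have hloc : ∀ x ∈ Ω, ∃ c : ℝ, ∀ᶠ s in 𝓝[>] (0 : ℝ), ∀ᵐ y, y ∈ ball x s → g y = c := by
    intro x hx
    obtain ⟨ε, hε, hεΩ⟩ := Metric.isOpen_iff.1 hΩ x hx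
    obtain ⟨c, hc⟩ := exists_ae_eq_const_ball hg (x₀ := x) (half_pos hε)
      (fun φ hφ hs v => by
        rw [mul_div_cancel₀ _ (two_ne_zero' ℝ)] at hs
        rw [← h φ hφ (hs.trans hεΩ) v, ← integral_indicator hΩ.measurableSet]
        congr 1 with y
        by_cases hy : y ∈ Ω <;> simp [g, hy])
    refine ⟨c, ?_⟩
    filter_upwards [Ioo_mem_nhdsGT (half_pos hε)] with s hs
    filter_upwards [hc] with y hy hys using hy (ball_subset_ball hs.2.le hys)
  choose! f hf using hloc
  have : PreconnectedSpace Ω := isPreconnected_iff_preconnectedSpace.1 hc.isPreconnected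
  -- The local constants at nearby points agree because both describe `g` on a common small ball of
  -- positive measure.
  have hlc : IsLocallyConstant (fun x : Ω => f x) := by
    rw [IsLocallyConstant.iff_eventually_eq]
    rintro ⟨x, hx⟩
    obtain ⟨s, hs, hs0⟩ := ((hf x hx).and self_mem_nhdsWithin).exists
    have h1 : ∀ᶠ y : Ω in 𝓝 ⟨x, hx⟩, (y : Pt d) ∈ ball x s :=
      continuous_subtype_val.continuousAt.eventually (ball_mem_nhds x hs0)
    filter_upwards [h1] with y hy
    obtain ⟨ε, hε, hεs⟩ := Metric.isOpen_iff.1 isOpen_ball _ hy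
    obtain ⟨t, ht, ht0⟩ := ((hf y y.2).and (Ioo_mem_nhdsGT hε)).exists
    by_contra hne
    refine (measure_ball_pos (volume : Measure (Pt d)) (y : Pt d) ht0.1).ne' ?_
    refine measure_mono_null ?_ (ae_iff.1 (hs.and ht))
    intro z hz hz'
    exact hne ((hz'.2 hz).symm.trans (hz'.1 (hεs (ball_subset_ball ht0.2.le hz))))
  obtain ⟨x₀, hx₀⟩ := hc.nonempty
  refine ⟨f x₀, ?_⟩
  rw [ae_restrict_iff' hΩ.measurableSet, ae_iff]
  -- Connectedness makes the local constants equal, so the exceptional set is null near each of its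
  -- points.
  refine measure_null_of_locally_null _ fun x hx => ?_
  have hxΩ : x ∈ Ω := by by_contra hn; exact hx fun h' => absurd h' hn
  obtain ⟨s, hs, hs0⟩ := ((hf x hxΩ).and self_mem_nhdsWithin).exists
  refine ⟨{y | ¬ (y ∈ Ω → q y = f x₀)} ∩ ball x s,
    inter_mem_nhdsWithin _ (ball_mem_nhds x hs0), ?_⟩
  refine measure_mono_null ?_ (ae_iff.1 hs)
  intro z hz hz'
  refine hz.1 fun hzΩ => ?_
  have h2 : f x = f x₀ := hlc.apply_eq_of_preconnectedSpace ⟨x, hxΩ⟩ ⟨x₀, hx₀⟩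
  rw [← h2, ← hz' hz.2]
  simp [g, hzΩ]

end WeakGradient

/-! ### Finite-dimensional pressures and the range of the divergence -/

section DivergenceRange

open Filter Topology

theorem continuous_pEval (p : MvPolynomial (Fin d) ℝ) : Continuous (pEval p) :=
  (MvPolynomial.continuous_eval p).comp (PiLp.continuous_ofLp 2 _)

theorem memLp_of_continuous (hb : Bornology.IsBounded Ω) {f : Pt d → ℝ} (hf : Continuous f) :
    MemLp f 2 (volume.restrict Ω) := by
  have hc : IsCompact (closure Ω) := hb.isCompact_closure
  obtain ⟨C, hC⟩ := hc.exists_bound_of_continuousOn hf.continuousOn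
  have : IsFiniteMeasure ((volume : Measure (Pt d)).restrict (closure Ω)) :=
    ⟨by simpa using hc.measure_lt_top⟩
  have h : MemLp f 2 (volume.restrict (closure Ω)) :=
    MemLp.of_bound hf.aestronglyMeasurable C
      ((ae_restrict_iff' isClosed_closure.measurableSet).2 (Eventually.of_forall hC))
  exact h.mono_measure (Measure.restrict_mono subset_closure le_rfl)

theorem memLp_sum_indicator_pEval (hb : Bornology.IsBounded Ω) (M : Mesh Ω)
    (p : M.elements → MvPolynomial (Fin d) ℝ) :
    MemLp (fun x => ∑ T, (cell T.1).indicator (pEval (p T)) x) 2 (volume.restrict Ω) :=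
  memLp_finsetSum _ fun T _ =>
    (memLp_of_continuous hb (continuous_pEval (p T))).indicator (measurableSet_cell T.1)

/-- The piecewise polynomial field with given polynomials on the elements. -/
noncomputable def piecewisePoly (hb : Bornology.IsBounded Ω) (M : Mesh Ω) (k : ℕ) :
    (M.elements → MvPolynomial.restrictTotalDegree (Fin d) ℝ k) →ₗ[ℝ] L2 Ω where
  toFun p := (memLp_sum_indicator_pEval hb M fun T => (p T : MvPolynomial (Fin d) ℝ)).toLp
  map_add' p r := by
    rw [← MemLp.toLp_add]
    congr 1
    ext x
    simp only [Pi.add_apply, ← Finset.sum_add_distrib]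
    refine Finset.sum_congr rfl fun T _ => ?_
    by_cases hx : x ∈ cell T.1 <;> simp [hx, pEval]
  map_smul' c p := by
    rw [RingHom.id_apply, ← MemLp.toLp_const_smul]
    congr 1
    ext x
    simp only [Pi.smul_apply, Finset.smul_sum]
    refine Finset.sum_congr rfl fun T _ => ?_
    by_cases hx : x ∈ cell T.1 <;> simp [hx, pEval]

theorem Mesh.ae_eq_of_mem_cell (M : Mesh Ω) : ∀ᵐ x ∂(volume.restrict Ω),
    ∀ T T' : M.elements, x ∈ cell T.1 → x ∈ cell T'.1 → T = T' := by
  refine ae_restrict_of_ae (ae_all_iff.2 fun T => ae_all_iff.2 fun T' => ?_)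
  by_cases h : T = T'
  · exact Eventually.of_forall fun _ _ _ => h
  have h0 := M.aedisjoint_cell T.2 T'.2 (fun h' => h (Subtype.ext h'))
  filter_upwards [compl_mem_ae_iff.2 h0] with x hx h1 h2
  exact absurd ⟨h1, h2⟩ hx

/-- The space lies in the image of finitely many copies of a polynomial space of bounded degree. -/
theorem finiteDimensional_QSpace (hΩ : IsOpen Ω) (hb : Bornology.IsBounded Ω) (M : Mesh Ω)
    (k : ℕ) : FiniteDimensional ℝ (QSpace M k) := by
  refine Submodule.finiteDimensional_of_le (S₂ := LinearMap.range (piecewisePoly hb M k)) ?_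
  intro q hq
  have h1 : ∀ T : M.elements, ∃ p : MvPolynomial.restrictTotalDegree (Fin d) ℝ k,
      ∀ᵐ x ∂(volume.restrict Ω), x ∈ cell T.1 → q x = pEval (p : MvPolynomial (Fin d) ℝ) x := by
    intro T
    obtain ⟨p, hp, h⟩ := hq T.1 T.2
    exact ⟨⟨p, (MvPolynomial.mem_restrictTotalDegree _ _ _).2 hp⟩, h⟩
  choose p hp using h1
  refine ⟨p, Lp.ext ?_⟩
  refine (MemLp.coeFn_toLp (memLp_sum_indicator_pEval hb M
    fun T => (p T : MvPolynomial (Fin d) ℝ))).trans ?_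
  -- Almost every point lies in exactly one cell, so the sum of indicators reduces to a single term.
  filter_upwards [ae_all_iff.2 hp, M.ae_eq_of_mem_cell, ae_restrict_mem hΩ.measurableSet]
    with x h2 h3 hx
  obtain ⟨T, hT, hxT⟩ := M.exists_mem_cell hx
  rw [Finset.sum_eq_single_of_mem (⟨T, hT⟩ : M.elements) (Finset.mem_univ _),
    Set.indicator_of_mem hxT, h2 ⟨T, hT⟩ hxT]
  intro T' _ hne
  exact Set.indicator_of_notMem (fun hx' => hne (h3 _ _ hx' hxT)) _

/-- Lets the constant `1` be used as a test function in the normal trace condition. -/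
theorem exists_isTest_eq_one (hb : Bornology.IsBounded Ω) :
    ∃ φ : Pt d → ℝ, IsTest φ ∧ ∀ x ∈ Ω, φ x = 1 ∧ fderiv ℝ φ x = 0 := by
  obtain ⟨r, hr, hΩr⟩ := hb.subset_ball_lt 0 (0 : Pt d)
  let ψ : ContDiffBump (0 : Pt d) := ⟨r, r + 1, hr, by linarith⟩
  refine ⟨ψ, ⟨ψ.contDiff, ψ.hasCompactSupport⟩, fun x hx => ?_⟩
  have h := hΩr hx
  refine ⟨ψ.one_of_mem_closedBall (Metric.ball_subset_closedBall h), ?_⟩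
  have h1 : (ψ : Pt d → ℝ) =ᶠ[𝓝 x] fun _ => 1 := by
    filter_upwards [Metric.isOpen_ball.mem_nhds h] with y hy
      using ψ.one_of_mem_closedBall (Metric.ball_subset_closedBall hy)
  rw [h1.fderiv_eq]
  simp

/-- Fields with vanishing normal trace have mean-free divergence. -/
theorem zeroMean_weakDiv (hΩ : IsOpen Ω) (hb : Bornology.IsBounded Ω) {u : L2v Ω}
    (hu : u ∈ H0div Ω) : ZeroMean Ω (weakDiv Ω u) := by
  obtain ⟨φ, hφ, h1⟩ := exists_isTest_eq_one hb
  have h := normalTraceZero_weakDiv hΩ hu φ hφ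
  have e1 : ∫ x in Ω, fderiv ℝ φ x (u x) = 0 :=
    setIntegral_eq_zero_of_forall_eq_zero fun x hx => by rw [(h1 x hx).2]; rfl
  have e2 : ∫ x in Ω, weakDiv Ω u x * φ x = ∫ x in Ω, weakDiv Ω u x :=
    setIntegral_congr_fun hΩ.measurableSet fun x hx => by
      rw [(h1 x hx).1, mul_one]
  rwa [e1, e2, zero_add] at h

/-- The field `φ v` with a test function `φ` supported in `Ω` belongs to `H₀(div, Ω)`. -/
theorem exists_mem_H0div_weakDiv (hΩ : IsOpen Ω) {φ : Pt d → ℝ} (hφ : IsTest φ)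
    (hs : tsupport φ ⊆ Ω) (v : Pt d) :
    ∃ u ∈ H0div Ω, weakDiv Ω u =ᵐ[volume.restrict Ω] fun x => fderiv ℝ φ x v := by
  have hc : Continuous (fderiv ℝ φ) := hφ.1.continuous_fderiv (by simp)
  have hcv : Continuous fun x => fderiv ℝ φ x v := hc.clm_apply continuous_const
  have hsv : HasCompactSupport fun x => fderiv ℝ φ x v :=
    (hφ.2.fderiv (𝕜 := ℝ)).comp_left (g := fun L : Pt d →L[ℝ] ℝ => L v) (by simp)
  have hu : MemLp (fun x => φ x • v) 2 (volume.restrict Ω) :=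
    ((hφ.1.continuous.smul continuous_const).memLp_of_hasCompactSupport
      (hφ.2.smul_right)).restrict Ω
  have hg : MemLp (fun x => fderiv ℝ φ x v) 2 (volume.restrict Ω) :=
    (hcv.memLp_of_hasCompactSupport hsv).restrict Ω
  -- Here `ψ` need not be supported in `Ω`. Since `φ` is, the integrals extend to the whole space
  -- and integration by parts has no boundary term.
  have hN : NormalTraceZero Ω hu.toLp hg.toLp := by
    intro ψ hψ
    have hψc : Continuous (fderiv ℝ ψ) := hψ.1.continuous_fderiv (by simp)
    have hψv : Continuous fun x => fderiv ℝ ψ x v := hψc.clm_apply continuous_const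
    have e1 : ∫ x in Ω, fderiv ℝ ψ x ((hu.toLp : L2v Ω) x) = ∫ x, φ x * fderiv ℝ ψ x v := by
      refine (integral_congr_ae ?_).trans
        (setIntegral_eq_integral_of_forall_compl_eq_zero fun x hx => by
          rw [image_eq_zero_of_notMem_tsupport fun hx' => hx (hs hx'), zero_mul])
      filter_upwards [hu.coeFn_toLp] with x hx
      rw [hx, map_smul, smul_eq_mul]
    have e2 : ∫ x in Ω, (hg.toLp : L2 Ω) x * ψ x = ∫ x, fderiv ℝ φ x v * ψ x := by
      refine (integral_congr_ae ?_).trans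
        (setIntegral_eq_integral_of_forall_compl_eq_zero fun x hx => by
          rw [image_eq_zero_of_notMem_tsupport (f := fderiv ℝ φ)
            fun hx' => hx (hs (tsupport_fderiv_subset ℝ hx'))]
          simp)
      filter_upwards [hg.coeFn_toLp] with x hx
      rw [hx]
    rw [e1, e2, integral_mul_fderiv_eq_neg_fderiv_mul_of_integrable, neg_add_cancel]
    · exact (hcv.mul hψ.1.continuous).integrable_of_hasCompactSupport hsv.mul_right
    · exact (hφ.1.continuous.mul hψv).integrable_of_hasCompactSupport hφ.2.mul_right
    · exact (hφ.1.continuous.mul hψ.1.continuous).integrable_of_hasCompactSupport hφ.2.mul_right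
    · exact fun x _ => hφ.1.differentiable (by simp) x
    · exact fun x _ => hψ.1.differentiable (by simp) x
  refine ⟨hu.toLp, hN.mem_H0div, ?_⟩
  rw [hN.weakDiv_eq hΩ]
  exact hg.coeFn_toLp

/-- A mean-free function orthogonal to all divergences of `H₀(div, Ω)` vanishes. -/
theorem eq_zero_of_forall_inner_weakDiv (hΩ : IsBoundedLipschitzDomain Ω) {q : L2 Ω}
    (hq : ZeroMean Ω q) (h : ∀ u ∈ H0div Ω, inner ℝ (weakDiv Ω u) q = 0) : q = 0 := by
  obtain ⟨c, hc⟩ := exists_ae_eq_const hΩ.isOpen hΩ.isConnected q hΩ.isBounded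
    (fun φ hφ hs v => by
      obtain ⟨u, hu, hdiv⟩ := exists_mem_H0div_weakDiv hΩ.isOpen hφ hs v
      rw [← h u hu, L2.inner_def]
      refine integral_congr_ae ?_
      filter_upwards [hdiv] with x hx
      simp [hx, mul_comm])
  rw [ZeroMean, integral_congr_ae hc, setIntegral_const, smul_eq_mul, mul_eq_zero] at hq
  have hv : (volume.real Ω) ≠ 0 := by
    rw [Measure.real, ENNReal.toReal_ne_zero]
    exact ⟨(hΩ.isOpen.measure_pos volume hΩ.isConnected.nonempty).ne',
      hΩ.isBounded.measure_lt_top.ne⟩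
  have hc0 := hq.resolve_left hv
  refine Lp.ext ?_
  filter_upwards [hc, Lp.coeFn_zero ℝ 2 (volume.restrict Ω)] with x h1 h2
  rw [h1, h2, hc0]; rfl

end DivergenceRange

theorem integrable_of_isBounded (hb : Bornology.IsBounded Ω) (q : L2 Ω) :
    Integrable q (volume.restrict Ω) := by
  have : IsFiniteMeasure ((volume : Measure (Pt d)).restrict Ω) :=
    ⟨by simpa using hb.measure_lt_top⟩
  exact (Lp.memLp q).integrable (by norm_num)

theorem ZeroMean.sub (hb : Bornology.IsBounded Ω) {p q : L2 Ω} (hp : ZeroMean Ω p)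
    (hq : ZeroMean Ω q) : ZeroMean Ω (p - q) := by
  rw [ZeroMean, integral_congr_ae (Lp.coeFn_sub p q)]
  simp only [Pi.sub_apply]
  rw [integral_sub (integrable_of_isBounded hb p) (integrable_of_isBounded hb q), hp, hq, sub_zero]

/-- Expresses the mean as a pairing with a discrete function, so that the `L²` projection preserves
mean zero. -/
theorem exists_const_one_mem_QSpace (hb : Bornology.IsBounded Ω) (M : Mesh Ω) (k : ℕ) :
    ∃ e ∈ QSpace M k, ∀ q : L2 Ω, inner ℝ q e = ∫ x in Ω, q x := by
  have h1 : MemLp (fun _ : Pt d => (1 : ℝ)) 2 (volume.restrict Ω) :=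
    memLp_of_continuous hb continuous_const
  refine ⟨h1.toLp, fun T _ => ⟨1, by simp, ?_⟩, fun q => ?_⟩
  · filter_upwards [h1.coeFn_toLp] with x hx _
    rw [hx]; simp [pEval]
  · rw [L2.inner_def]
    refine integral_congr_ae ?_
    filter_upwards [h1.coeFn_toLp] with x hx
    rw [hx]; simp

/-! ### Surjectivity of the discrete divergence and the classical inf-sup constant -/

section Interpolation

variable {M : Mesh Ω} {k : ℕ} {π : H0div Ω →ₗ[ℝ] VSpace M k}

/-- The divergence maps `V_H^k` onto the mean-free piecewise polynomials. -/
theorem exists_weakDiv_eq (hΩ : IsBoundedLipschitzDomain Ω) (hπ : IsQuasiInterpolation M k π)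
    {q : L2 Ω} (hq : q ∈ QSpace0 M k) : ∃ v ∈ VSpace M k, weakDiv Ω v = q := by
  let D : Submodule ℝ (L2 Ω) := LinearMap.range ((divL hΩ.isOpen).comp (VSpace.incl M k))
  have hDmem : ∀ v (hv : v ∈ VSpace M k), weakDiv Ω v ∈ D := fun v hv => ⟨⟨v, hv⟩, rfl⟩
  have hDQ : D ≤ QSpace M k := by
    rintro _ ⟨v, rfl⟩
    exact weakDiv_mem_QSpace hπ v.2
  have := finiteDimensional_QSpace hΩ.isOpen hΩ.isBounded M k
  have : FiniteDimensional ℝ D := Submodule.finiteDimensional_of_le hDQ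
  obtain ⟨y, hy, z, hz, rfl⟩ := D.exists_add_mem_mem_orthogonal q
  have hzq : z = y + z - y := by abel
  have hzQ : z ∈ QSpace M k := hzq ▸ sub_mem hq.1 (hDQ hy)
  have hy0 : ZeroMean Ω y := by
    obtain ⟨v, rfl⟩ := hy
    exact zeroMean_weakDiv hΩ.isOpen hΩ.isBounded v.2.2
  have hz0 : ZeroMean Ω z := by
    rw [hzq]; exact hq.2.sub hΩ.isBounded hy0
  have hzero : z = 0 := by
    -- For any `u` in `H₀(div)`, `(div u, z) = (div π u, z)` because `z` is discrete, and the right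
    -- side vanishes because `z` is orthogonal to `D`.
    refine eq_zero_of_forall_inner_weakDiv hΩ hz0 fun u hu => ?_
    have h1 := (hπ.commuting ⟨u, hu⟩).2 z hzQ
    have h2 := (Submodule.mem_orthogonal _ _).1 hz _ (hDmem _ (π ⟨u, hu⟩).2)
    rw [inner_sub_left, h2, sub_zero] at h1
    exact h1
  obtain ⟨v, rfl⟩ := hy
  exact ⟨v, v.2, by rw [hzero, add_zero]; rfl⟩

theorem exists_rightInverse_on_range {V W : Type*} [AddCommGroup V] [Module ℝ V]
    [AddCommGroup W] [Module ℝ W] (f : V →ₗ[ℝ] W) :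
    ∃ R : LinearMap.range f →ₗ[ℝ] V, ∀ q, f (R q) = q := by
  obtain ⟨R, hR⟩ := f.rangeRestrict.exists_rightInverse_of_surjective f.range_rangeRestrict
  exact ⟨R, fun q => congrArg Subtype.val (LinearMap.congr_fun hR q)⟩

/-- A linear right inverse of the divergence on the discrete spaces. -/
theorem exists_weakDiv_rightInverse (hΩ : IsBoundedLipschitzDomain Ω)
    (hπ : IsQuasiInterpolation M k π) :
    ∃ Q₀ : Submodule ℝ (L2 Ω), (∀ q, q ∈ Q₀ ↔ q ∈ QSpace0 M k) ∧ FiniteDimensional ℝ Q₀ ∧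
      ∃ R : Q₀ →ₗ[ℝ] L2v Ω, ∀ q : Q₀, R q ∈ VSpace M k ∧ weakDiv Ω (R q) = q := by
  let δ : VSpace M k →ₗ[ℝ] L2 Ω := (divL hΩ.isOpen).comp (VSpace.incl M k)
  have hQ : LinearMap.range δ ≤ QSpace M k := by
    rintro _ ⟨v, rfl⟩
    exact weakDiv_mem_QSpace hπ v.2
  have := finiteDimensional_QSpace hΩ.isOpen hΩ.isBounded M k
  obtain ⟨R, hR⟩ := exists_rightInverse_on_range δ
  refine ⟨LinearMap.range δ, fun q => ⟨fun hq => ⟨hQ hq, ?_⟩, fun hq => ?_⟩,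
    Submodule.finiteDimensional_of_le hQ, (VSpace M k).subtype.comp R, fun q => ⟨(R q).2, ?_⟩⟩
  · obtain ⟨v, rfl⟩ := hq
    exact zeroMean_weakDiv hΩ.isOpen hΩ.isBounded v.2.2
  · obtain ⟨v, hv, rfl⟩ := exists_weakDiv_eq hΩ hπ hq
    exact ⟨⟨v, hv⟩, rfl⟩
  · exact hR q

theorem hdivNorm_nonneg (u : L2v Ω) : 0 ≤ hdivNorm Ω u := Real.sqrt_nonneg _

theorem norm_weakDiv_le_hdivNorm (u : L2v Ω) : ‖weakDiv Ω u‖ ≤ hdivNorm Ω u :=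
  Real.le_sqrt_of_sq_le (by nlinarith [sq_nonneg ‖u‖])

theorem infSup_pos (hΩ : IsBoundedLipschitzDomain Ω) (hπ : IsQuasiInterpolation M k π) :
    ∃ ρ : ℝ, 0 < ρ ∧ (ρ : EReal) ≤ infSup (VSpace M k : Set (L2v Ω)) (QSpace0 M k) := by
  obtain ⟨Q₀, hQ₀, hfin, R, hR⟩ := exists_weakDiv_rightInverse hΩ hπ
  let C := ‖LinearMap.toContinuousLinearMap R‖
  have hC : ∀ q, ‖R q‖ ≤ C * ‖q‖ := (LinearMap.toContinuousLinearMap R).le_opNorm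
  have hpos : 0 < Real.sqrt (C ^ 2 + 1) := Real.sqrt_pos.2 (by positivity)
  -- For `v = R q` one has `b(v, q) = ‖q‖²` and `‖v‖² + ‖div v‖² ≤ (C² + 1) ‖q‖²`.
  refine ⟨(Real.sqrt (C ^ 2 + 1))⁻¹, inv_pos.2 hpos, le_iInf₂ fun q hq => ?_⟩
  obtain ⟨hq, hq0⟩ := hq
  have hqn : 0 < ‖q‖ := norm_pos_iff.2 hq0
  obtain ⟨hv, hdiv⟩ := hR ⟨q, (hQ₀ q).2 hq⟩
  have hCq := hC ⟨q, (hQ₀ q).2 hq⟩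
  set v := R ⟨q, (hQ₀ q).2 hq⟩
  have hv0 : v ≠ 0 := fun h => hq0 (by
    rw [h, weakDiv_zero hΩ.isOpen] at hdiv; exact hdiv.symm)
  refine le_iSup₂_of_le v ⟨hv, hv0⟩ (EReal.coe_le_coe_iff.2 ?_)
  have h1 : hdivNorm Ω v ≤ Real.sqrt (C ^ 2 + 1) * ‖q‖ := by
    rw [hdivNorm, hdiv]
    refine Real.sqrt_le_iff.2 ⟨by positivity, ?_⟩
    rw [mul_pow, Real.sq_sqrt (by positivity)]
    have := pow_le_pow_left₀ (norm_nonneg v) hCq 2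
    rw [mul_pow] at this
    change ‖v‖ ^ 2 + ‖q‖ ^ 2 ≤ _
    change ‖v‖ ^ 2 ≤ C ^ 2 * ‖q‖ ^ 2 at this
    linarith
  have h2 : 0 < hdivNorm Ω v := hqn.trans_le (by
    have := norm_weakDiv_le_hdivNorm v
    rwa [hdiv] at this)
  rw [formB, hdiv, real_inner_self_eq_norm_sq, le_div_iff₀ (by positivity), inv_mul_le_iff₀ hpos]
  nlinarith

/-! ### Stability and well-posedness of the multiscale problem -/

variable {A : Pt d → Matrix (Fin d) (Fin d) ℝ} {α β : ℝ}

theorem weakDiv_sub_corrector (hπ : IsQuasiInterpolation M k π) (hΩ : IsOpen Ω)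
    (hA : IsCoefficient Ω A α β) (hβ : 0 ≤ β) {v : L2v Ω} (hv : v ∈ H0div Ω) :
    weakDiv Ω (v - corrector A π v) = weakDiv Ω v := by
  obtain ⟨h1, h2, -⟩ := corrector_mem hπ hΩ hA hβ v
  rw [weakDiv_sub hΩ hv h1, h2, sub_zero]

theorem hdivNorm_sub_corrector_le (hπ : IsQuasiInterpolation M k π) (hΩ : IsOpen Ω)
    (hA : IsCoefficient Ω A α β) (hβ : 0 ≤ β) {v : L2v Ω} (hv : v ∈ H0div Ω) :
    hdivNorm Ω (v - corrector A π v) ≤ (1 + α⁻¹ * β) * hdivNorm Ω v := by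
  have hκ : 0 ≤ α⁻¹ * β := mul_nonneg (inv_nonneg.2 hA.alpha_pos.le) hβ
  have h1 : ‖v - corrector A π v‖ ≤ (1 + α⁻¹ * β) * ‖v‖ := by
    have := norm_sub_le v (corrector A π v)
    have := norm_corrector_le hπ hΩ hA hβ v
    linarith
  rw [hdivNorm, hdivNorm, weakDiv_sub_corrector hπ hΩ hA hβ hv]
  refine Real.sqrt_le_iff.2 ⟨by positivity, ?_⟩
  rw [mul_pow, Real.sq_sqrt (by positivity), mul_add, ← mul_pow]
  refine add_le_add (pow_le_pow_left₀ (norm_nonneg _) h1 2) ?_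
  exact le_mul_of_one_le_left (sq_nonneg _) (one_le_pow₀ (by linarith))

/-- The competitor `v - 𝒞 v` has the same numerator as `v` and a denominator larger by at most the
factor `1 + α⁻¹ β`. -/
theorem le_supQuot_VMs (hΩ : IsBoundedLipschitzDomain Ω) (hπ : IsQuasiInterpolation M k π)
    (hA : IsCoefficient Ω A α β) (hβ : 0 ≤ β) {ρ : ℝ} (hρ : 0 < ρ) {q : L2 Ω} (hq : q ≠ 0)
    (h : (ρ : EReal) ≤ supQuot (VSpace M k : Set (L2v Ω)) q) :
    ((ρ * (1 + α⁻¹ * β)⁻¹ : ℝ) : EReal) ≤ supQuot (VMs A π) q := by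
  have hκ : 0 < 1 + α⁻¹ * β := by
    have := mul_nonneg (inv_nonneg.2 hA.alpha_pos.le) hβ
    linarith
  have hqn : 0 < ‖q‖ := norm_pos_iff.2 hq
  by_contra! hcon
  obtain ⟨c, hc1, hc2⟩ := EReal.lt_iff_exists_real_btwn.1 hcon
  rw [EReal.coe_lt_coe_iff, ← div_eq_mul_inv, lt_div_iff₀ hκ] at hc2
  -- The maximum with `0` forces `b(v, q) > 0`, hence `div v ≠ 0`, so that `v - 𝒞 v` is a nonzero
  -- competitor.
  have ht : ((max (c * (1 + α⁻¹ * β)) 0 : ℝ) : EReal) <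
      supQuot (VSpace M k : Set (L2v Ω)) q :=
    (EReal.coe_lt_coe_iff.2 (max_lt hc2 hρ)).trans_le h
  simp only [supQuot, lt_iSup_iff, EReal.coe_lt_coe_iff, max_lt_iff] at ht
  obtain ⟨v, ⟨hv, hv0⟩, hcv, hpos⟩ := ht
  have hdiv := weakDiv_sub_corrector hπ hΩ.isOpen hA hβ hv.2
  have hle := hdivNorm_sub_corrector_le hπ hΩ.isOpen hA hβ hv.2
  have hnv : 0 < hdivNorm Ω v := by
    refine (hdivNorm_nonneg v).lt_of_ne' fun h0 => ?_
    rw [h0, mul_zero, div_zero] at hpos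
    exact lt_irrefl _ hpos
  have hb : 0 < formB v q := by
    rwa [div_pos_iff_of_pos_right (by positivity)] at hpos
  have hdiv0 : weakDiv Ω v ≠ 0 := fun h0 => by
    rw [formB, h0, inner_zero_left] at hb
    exact lt_irrefl _ hb
  set u := v - corrector A π v with hu
  have hu0 : u ≠ 0 := fun h0 => hdiv0 (by rw [← hdiv, h0, weakDiv_zero hΩ.isOpen])
  have hnu : 0 < hdivNorm Ω u :=
    (norm_pos_iff.2 (hdiv ▸ hdiv0)).trans_le (norm_weakDiv_le_hdivNorm u)
  have hbu : formB u q = formB v q := by rw [formB, formB, hdiv]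
  have h1 : ((formB u q / (‖q‖ * hdivNorm Ω u) : ℝ) : EReal) ≤ supQuot (VMs A π) q :=
    le_iSup₂ (f := fun (v : L2v Ω) (_ : v ∈ VMs A π \ {0}) =>
      ((formB v q / (‖q‖ * hdivNorm Ω v) : ℝ) : EReal)) u ⟨⟨v, hv, rfl⟩, hu0⟩
  have h2 := EReal.coe_lt_coe_iff.1 (h1.trans_lt hc1)
  rw [hbu, div_lt_iff₀ (by positivity)] at h2
  rw [lt_div_iff₀ (by positivity)] at hcv
  have hc0 : 0 < c := by
    by_contra! hc0
    exact absurd (h2.trans_le (mul_nonpos_of_nonpos_of_nonneg hc0 (by positivity))) hb.not_gt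
  have h3 : c * (‖q‖ * hdivNorm Ω u) ≤ c * (‖q‖ * ((1 + α⁻¹ * β) * hdivNorm Ω v)) := by gcongr
  linarith

theorem formA_sub_left (hA : IsCoefficient Ω A α β) (hβ : 0 ≤ β) (u v w : L2v Ω) :
    formA A (u - v) w = formA A u w - formA A v w := by
  simp only [← formAL_apply hA hβ, map_sub, sub_apply]

theorem formA_sub_right (hA : IsCoefficient Ω A α β) (hβ : 0 ≤ β) (u v w : L2v Ω) :
    formA A u (v - w) = formA A u v - formA A u w := by
  simp only [← formAL_apply hA hβ, map_sub]

theorem exists_isIdealSolution (hΩ : IsBoundedLipschitzDomain Ω)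
    (hπ : IsQuasiInterpolation M k π) (hA : IsCoefficient Ω A α β) (hβ : 0 ≤ β) {f : L2 Ω}
    (hf : ZeroMean Ω f) : ∃ u p, IsIdealSolution A π f u p := by
  obtain ⟨Q₀, hQ₀, hfin, R, hR⟩ := exists_weakDiv_rightInverse hΩ hπ
  have := finiteDimensional_QSpace hΩ.isOpen hΩ.isBounded M k
  -- `g` is `P_H f`; it inherits mean zero from `f`, so `-g` is the divergence of a discrete field.
  obtain ⟨g, hg, z, hz, rfl⟩ := (QSpace M k).exists_add_mem_mem_orthogonal f
  have hzq : ∀ q ∈ QSpace M k, inner ℝ z q = 0 := (Submodule.mem_orthogonal' _ _).1 hz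
  have hg0 : ZeroMean Ω g := by
    obtain ⟨e, he, hint⟩ := exists_const_one_mem_QSpace hΩ.isBounded M k
    rw [ZeroMean, ← hint, inner_add_left, hzq e he, add_zero, hint] at hf
    exact hf
  have hgQ₀ : -g ∈ Q₀ := neg_mem ((hQ₀ g).2 ⟨hg, hg0⟩)
  obtain ⟨hv, hdivv⟩ := hR ⟨-g, hgQ₀⟩
  set v := R ⟨-g, hgQ₀⟩
  -- The projection is onto all divergence-free fields, not only `W_{div 0}`: this makes `a(v - c,
  -- w)` a function of `div w`.
  obtain ⟨c, hc, hac⟩ := exists_formA_eq hA hβ (isClosed_divFree hΩ.isOpen) (formAL hA hβ v)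
  have hcK := mem_divFree.1 hc
  have hu : v - c ∈ H0div Ω := sub_mem hv.2 hcK.1
  have hdivu : weakDiv Ω (v - c) = -g := by
    rw [weakDiv_sub hΩ.isOpen hv.2 hcK.1, hdivv, hcK.2, sub_zero]
  have hau : ∀ w ∈ H0div Ω, weakDiv Ω w = 0 → formA A (v - c) w = 0 := fun w hw hw0 => by
    rw [formA_sub_left hA hβ, hac w (mem_divFree.2 ⟨hw, hw0⟩), formAL_apply, sub_self]
  let ℓ : Q₀ →L[ℝ] ℝ := LinearMap.toContinuousLinearMap
    (-((formAL hA hβ (v - c) : L2v Ω →ₗ[ℝ] ℝ).comp R))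
  -- The pressure represents `q ↦ -a(u, R q)`; the choice of the lift `R q` is immaterial by `hau`.
  let p : Q₀ := (InnerProductSpace.toDual ℝ Q₀).symm ℓ
  have hp : ∀ q : Q₀, inner ℝ (q : L2 Ω) (p : L2 Ω) = - formA A (v - c) (R q) := fun q => by
    have h1 : inner ℝ p q = ℓ q := InnerProductSpace.toDual_symm_apply
    rw [real_inner_comm, ← Submodule.coe_inner, h1, ← formAL_apply hA hβ]
    rfl
  refine ⟨v - c, p, ⟨?_, (hQ₀ _).1 p.2, fun w hw => ?_, fun q hq => ?_⟩⟩
  · refine (mem_VMs_iff hπ hΩ.isOpen hA hβ).2 ⟨hu, hdivu ▸ neg_mem hg, ?_⟩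
    rintro w ⟨hw, hw0, -⟩
    exact hau w hw hw0
  · obtain ⟨hw1, hw2, -⟩ := (mem_VMs_iff hπ hΩ.isOpen hA hβ).1 hw
    have hwQ : weakDiv Ω w ∈ Q₀ :=
      (hQ₀ _).2 ⟨hw2, zeroMean_weakDiv hΩ.isOpen hΩ.isBounded hw1⟩
    obtain ⟨hr, hdivr⟩ := hR ⟨_, hwQ⟩
    have h1 := hau (w - R ⟨_, hwQ⟩) (sub_mem hw1 hr.2) (by
      rw [weakDiv_sub hΩ.isOpen hw1 hr.2, hdivr, sub_self])
    rw [formA_sub_right hA hβ] at h1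
    have h2 := hp ⟨_, hwQ⟩
    rw [formB, h2]
    linarith
  · rw [formB, hdivu, inner_neg_left, inner_add_left, hzq q hq, add_zero]

theorem IsIdealSolution.unique (hΩ : IsBoundedLipschitzDomain Ω)
    (hπ : IsQuasiInterpolation M k π) (hA : IsCoefficient Ω A α β) (hβ : 0 ≤ β) {f : L2 Ω}
    {u u' : L2v Ω} {p p' : L2 Ω} (h : IsIdealSolution A π f u p)
    (h' : IsIdealSolution A π f u' p') : u = u' ∧ p = p' := by
  obtain ⟨hu1, hu2, hu3⟩ := (mem_VMs_iff hπ hΩ.isOpen hA hβ).1 h.mem_velocity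
  obtain ⟨hu1', hu2', hu3'⟩ := (mem_VMs_iff hπ hΩ.isOpen hA hβ).1 h'.mem_velocity
  have hdiv : weakDiv Ω (u - u') = 0 := by
    have hQ : weakDiv Ω (u - u') ∈ QSpace M k := by
      rw [weakDiv_sub hΩ.isOpen hu1 hu1']; exact sub_mem hu2 hu2'
    -- The divergence of the difference is itself an admissible test function, hence orthogonal to
    -- itself.
    have h1 := h.mass _ hQ
    have h2 := h'.mass _ hQ
    rw [formB] at h1 h2
    rw [← inner_self_eq_zero (𝕜 := ℝ)]
    nth_rewrite 1 [weakDiv_sub hΩ.isOpen hu1 hu1']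
    rw [inner_sub_left, h1, h2, sub_self]
  have he : u - u' ∈ VMs A π := by
    refine (mem_VMs_iff hπ hΩ.isOpen hA hβ).2
      ⟨sub_mem hu1 hu1', hdiv ▸ zero_mem _, fun w hw => ?_⟩
    rw [formA_sub_left hA hβ, hu3 w hw, hu3' w hw, sub_self]
  have huu : u - u' = 0 := by
    refine eq_zero_of_formA_self hA hβ ?_
    have h1 := h.momentum _ he
    have h2 := h'.momentum _ he
    rw [formB, hdiv, inner_zero_left, add_zero] at h1 h2
    rw [formA_sub_left hA hβ, h1, h2, sub_self]
  have hu := sub_eq_zero.1 huu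
  refine ⟨hu, sub_eq_zero.1 ?_⟩
  subst hu
  -- A discrete field with divergence `p - p'`, corrected without changing its divergence, tests the
  -- momentum equations and gives `‖p - p'‖² = 0`.
  obtain ⟨v, hv, hvp⟩ := exists_weakDiv_eq hΩ hπ (q := p - p')
    ⟨sub_mem h.mem_pressure.1 h'.mem_pressure.1,
      h.mem_pressure.2.sub hΩ.isBounded h'.mem_pressure.2⟩
  have hms : v - corrector A π v ∈ VMs A π := ⟨v, hv, rfl⟩
  have h1 := h.momentum _ hms
  have h2 := h'.momentum _ hms
  rw [formB, weakDiv_sub_corrector hπ hΩ.isOpen hA hβ hv.2, hvp] at h1 h2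
  rw [← inner_self_eq_zero (𝕜 := ℝ)]
  rw [inner_sub_right]
  linarith

end Interpolation

end MixedLOD

theorem lemma3p3 (d : ℕ) (hd : d = 2 ∨ d = 3) (Ω : Set (Pt d)) (hΩ : IsBoundedLipschitzDomain Ω)
    (A : Pt d → Matrix (Fin d) (Fin d) ℝ) (α β : ℝ) (hA : IsCoefficient Ω A α β)
    (M : Mesh Ω) (k : ℕ)
    (π : H0div Ω →ₗ[ℝ] VSpace M k) (hπ : IsQuasiInterpolation M k π) :
    -- the classical pair has a positive inf-sup constant
    (∃ ρ : ℝ, 0 < ρ ∧ (ρ : EReal) ≤ infSup (VSpace M k : Set (L2v Ω)) (QSpace0 M k)) ∧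
    -- any such constant gives the inf-sup stability of the multiscale pair
    (∀ ρ : ℝ, 0 < ρ → (ρ : EReal) ≤ infSup (VSpace M k : Set (L2v Ω)) (QSpace0 M k) →
      ∀ q ∈ QSpace0 M k, q ≠ 0 →
        ((ρ * (1 + α⁻¹ * β)⁻¹ : ℝ) : EReal) ≤ supQuot (VMs A π) q) ∧
    -- well-posedness of the ideal multiscale problem
    (∀ f : L2 Ω, ZeroMean Ω f →
      ∃! up : L2v Ω × L2 Ω, IsIdealSolution A π f up.1 up.2) := by
  have hd0 : 0 < d := by omega
  have hβ : 0 ≤ β := hA.alpha_pos.le.trans (hA.alpha_le_beta hd0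
    (hΩ.isOpen.measure_pos volume hΩ.isConnected.nonempty).ne')
  refine ⟨infSup_pos hΩ hπ, fun ρ hρ h q hq hq0 => ?_, fun f hf => ?_⟩
  · exact le_supQuot_VMs hΩ hπ hA hβ hρ hq0 (h.trans (iInf₂_le q ⟨hq, hq0⟩))
  · obtain ⟨u, p, hup⟩ := exists_isIdealSolution hΩ hπ hA hβ hf
    refine ⟨(u, p), hup, fun up hup' => ?_⟩
    obtain ⟨h1, h2⟩ := IsIdealSolution.unique hΩ hπ hA hβ hup' hup
    exact Prod.ext h1 h2
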